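/- Two stacks in parallel process a word as follows: an operation either moves the next letter of the input onto the top of one of the two stacks, or moves the top letter of one of the two stacks to the end of the output; initially both stacks and the output are empty. A permutation $\sigma$ of length $n$ is 2sip-sortable if some sequence of operations turns the input $\sigma(1)\sigma(2)\cdots\sigma(n)$ into the output $12\cdots n$. Let $p_n$ be the number of 2sip-sortable permutations of length $n$ (so $p_0=1$), let $P(t)=\sum_{n\ge 0}p_n t^n$, and let $t_c$ be the radius of convergence of this power series. Theorem. For every $t\in[0,t_c]$ the series $P(t)$ converges (in particular at $t=t_c$), and $$\sqrt{2P(t)}\;\ge\;1+\sqrt{2tP(t)}.$$ -/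

import Mathlib

/-- A configuration of the machine with two stacks in parallel: what is left of the input (its head
is the next element), the two stacks (the head of each list is its top element), and what has been
output so far (the last element of the list is the one output last). -/
structure TwoStacks (α : Type*) where
  input : List α
  stack₁ : List α
  stack₂ : List α
  output : List α

namespace TwoStacks

/-- One operation of the machine: `in₁` and `in₂` move the next element of the input onto the top
of the first or second stack, `out₁` and `out₂` move the top element of the first or second stack
to the output. -/
inductive Step {α : Type*} : TwoStacks α → TwoStacks α → Prop
  | in₁ (a : α) (i s₁ s₂ o : List α) : Step ⟨a :: i, s₁, s₂, o⟩ ⟨i, a :: s₁, s₂, o⟩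
  | in₂ (a : α) (i s₁ s₂ o : List α) : Step ⟨a :: i, s₁, s₂, o⟩ ⟨i, s₁, a :: s₂, o⟩
  | out₁ (a : α) (i s₁ s₂ o : List α) : Step ⟨i, a :: s₁, s₂, o⟩ ⟨i, s₁, s₂, o ++ [a]⟩
  | out₂ (a : α) (i s₁ s₂ o : List α) : Step ⟨i, s₁, a :: s₂, o⟩ ⟨i, s₁, s₂, o ++ [a]⟩

/-- The permutation `σ(0) σ(1) ⋯ σ(n-1)` is sortable by two stacks in parallel: with this word as
input and both stacks empty, some finite sequence of operations outputs `0 1 ⋯ n-1`. -/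
def Sortable {n : ℕ} (σ : Equiv.Perm (Fin n)) : Prop :=
  Relation.ReflTransGen Step
    ⟨List.ofFn σ, [], [], []⟩ ⟨[], [], [], List.finRange n⟩

/-- The number `p_n` of permutations of length `n` that are sortable by two stacks in parallel. -/
noncomputable def count (n : ℕ) : ℕ :=
  Nat.card {σ : Equiv.Perm (Fin n) // Sortable σ}

/-- The value `P(t) = ∑ p_n t^n` of the generating function (meaningful where the series
converges). -/
noncomputable def P (t : ℝ) : ℝ :=
  ∑' n : ℕ, (count n : ℝ) * t ^ n

/-- The radius of convergence of the power series `∑ p_n t^n`. -/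
noncomputable def radius : ENNReal :=
  (FormalMultilinearSeries.ofScalars ℝ (fun n : ℕ => (count n : ℝ))).radius

end TwoStacks

/-!
Write `s = √t`. Since `√(2tP) = s √(2P)`, the inequality says `1 ≤ 2 P (1 - s)²`.

**Convergence.** If `σ` and `τ` are sortable, so is the word that starts with `|σ|`, continues with
`σ`, and then with `τ` shifted: the first letter waits below while `σ` is sorted. Hence
`1 + t P² ≤ P` (`genFun_mul_le`), so `t P(t) ≤ 1` below the radius, and the partial sums at the
radius inherit this bound. It also gives `t ≤ 1/4`.

**Arch systems.** A computation is a word of pushes and pops in which each element forms an arch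
from its push to its pop, and arches on the same stack do not cross. Only computations in which a
pop directly after a push takes the element just pushed are considered. Such a system of arches,
regardless of the stacks, is determined by the permutation it sorts (`eq_of_pushes_eq_of_pops_eq`),
so the generating function `1 + p` of these systems is at most `P` (`one_add_archSum_le`), and it
suffices to bound `q = 1 + p` from below.

**Substitution.** The arches connected through crossings to the first one form a primitive skeleton,
and the remaining arches fill its gaps with arch systems, in a unique way
(`exists_primitive_flat`, `flat_primitive_unique`). Up to swapping the stacks, a primitive system has
one colouring (`Primitive.colouring_unique`). Let `R(p)` count the systems whose skeleton is not a
single arch, as a function of the total weight `p` of nonempty gaps. Then `s² q² + R(p) ≤ p`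
(`primSum_le`). Now count coloured words, that is, computations with the choice of stacks, where a
pop directly after a push has weight `b`. Their sum `p'` is the limit of sums over words of length at
most `N`, which satisfy `p'_{N+1} ≤ 2 (s² (b + p'_N) (1 + p'_N) + R(p'_N))` (`colSum_succ_le`). If
`2 s² (1 - b) q = p`, the two relations give `p'_N ≤ p` for all `N` (`colSum_le`): the coloured count
converges.

**Growth.** Coloured words are closed paths in the quarter plane with a local weight. Their growth
rate is that of the unconstrained words, the eigenvalue `2 + √(2b)` of the transfer matrix: by the
pigeonhole principle, the long blocks with one and the same displacement have almost the full
weight, and concatenations of such blocks with reversed ones stay close to their starting point. So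
convergence forces `s (2 + √(2b)) ≤ 1` (`growth_bound`), which amounts to `1 / q ≤ 2 (1 - s)²`.
-/

open scoped ENNReal

namespace TwoStacks

variable {α β γ : Type*}

/-! ### Labelled words and arch systems -/

/-- The labels pushed by a word, in order. A letter is a pair: `true` for a push and `false` for a
pop, together with a label (or, in a coloured word, with the stack concerned). -/
def pushes (u : List (Bool × α)) : List α := (u.filter fun x => x.1).map Prod.snd

/-- The labels popped by a word, in order. -/
def pops (u : List (Bool × α)) : List α := (u.filter fun x => !x.1).map Prod.snd

@[simp] theorem pushes_nil : pushes ([] : List (Bool × α)) = [] := rfl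
@[simp] theorem pops_nil : pops ([] : List (Bool × α)) = [] := rfl
@[simp] theorem pushes_cons_true (a : α) (u) : pushes ((true, a) :: u) = a :: pushes u := rfl
@[simp] theorem pushes_cons_false (a : α) (u) : pushes ((false, a) :: u) = pushes u := rfl
@[simp] theorem pops_cons_true (a : α) (u) : pops ((true, a) :: u) = pops u := rfl
@[simp] theorem pops_cons_false (a : α) (u) : pops ((false, a) :: u) = a :: pops u := rfl
@[simp] theorem pushes_append (u v : List (Bool × α)) : pushes (u ++ v) = pushes u ++ pushes v := by
  simp [pushes]
@[simp] theorem pops_append (u v : List (Bool × α)) : pops (u ++ v) = pops u ++ pops v := by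
  simp [pops]

@[simp] theorem mem_pushes {u : List (Bool × α)} {a : α} : a ∈ pushes u ↔ (true, a) ∈ u := by
  simp [pushes]

@[simp] theorem mem_pops {u : List (Bool × α)} {a : α} : a ∈ pops u ↔ (false, a) ∈ u := by
  simp [pops]

/-- Every label of the word is both pushed and popped in it: the word is a union of arches. -/
def Closed (u : List (Bool × α)) : Prop := ∀ a, (true, a) ∈ u ↔ (false, a) ∈ u

/-- Arch systems: each label occurs in exactly one push and one pop, and is pushed before it is
popped. The arch of `a` joins `(true, a)` to `(false, a)`. -/
structure IsArch (u : List (Bool × α)) : Prop where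
  nodup : u.Nodup
  closed : Closed u
  order : ∀ a, ¬ [(false, a), (true, a)].Sublist u

/-- The colouring `c` of the labels assigns every arch to a stack so that no two arches on the same
stack cross. Arches `a` and `b` cross when `a` opens, `b` opens, `a` closes, `b` closes in this
order. -/
def NonCrossing (c : α → Bool) (u : List (Bool × α)) : Prop :=
  ∀ a b, c a = c b → ¬ [(true, a), (true, b), (false, a), (false, b)].Sublist u

/-- The word is not empty, and no nonempty closed factor occurs after its first letter. For an arch
system this says that the crossing graph of the arches is connected. -/
def Primitive (k : List (Bool × α)) : Prop :=
  k ≠ [] ∧ ∀ x v y, k = x ++ v ++ y → x ≠ [] → Closed v → v = []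

theorem Closed.nil : Closed ([] : List (Bool × α)) := by simp [Closed]

theorem Closed.mem_iff {u : List (Bool × α)} (hu : Closed u) (s t : Bool) (a : α) :
    (s, a) ∈ u ↔ (t, a) ∈ u := by
  cases s <;> cases t <;> simp [hu a]

/-! ### Rigidity of the colourings of a primitive arch system -/

/-- If crossing arches always have the same class `δ` and both classes occur, then some nonempty closed
factor occurs after the first letter. The induction shrinks a factor `m` in which the class other
than `κ` is closed: the first maximal run of that class is closed, or an arch leaves it, and the
letters strictly under this arch form a shorter factor with the roles of the classes exchanged. -/
theorem exists_closed_run {K : List (Bool × α)} (hK : IsArch K) (δ : α → Bool)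
    (hδ : ∀ a b, [(true, a), (true, b), (false, a), (false, b)].Sublist K → δ a = δ b)
    (n : ℕ) : ∀ (X m Y : List (Bool × α)) (κ : Bool), m.length ≤ n → K = X ++ m ++ Y →
      (∀ a, δ a ≠ κ → ((true, a) ∈ m ↔ (false, a) ∈ m)) →
      (X ≠ [] ∨ ∃ z m', m = z :: m' ∧ δ z.2 = κ) → (∃ z ∈ m, δ z.2 ≠ κ) →
      ∃ x v y, K = x ++ v ++ y ∧ x ≠ [] ∧ v ≠ [] ∧ Closed v := by
  induction n with
  | zero =>
    intro X m Y κ hm _ _ _ ⟨z, hz, _⟩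
    have : m = [] := List.length_eq_zero_iff.1 (by omega)
    simp [this] at hz
  | succ n ih =>
    intro X m Y κ hm hKm hcl hne ⟨z, hz, hzκ⟩
    -- `m = m1 ++ v ++ m2`, where `v` is the first maximal run of the class other than `κ`
    let p : Bool × α → Bool := fun x => δ x.2 == κ
    obtain ⟨m1, hm1⟩ : ∃ m1, m1 = m.takeWhile p := ⟨_, rfl⟩
    obtain ⟨r, hr⟩ : ∃ r, r = m.dropWhile p := ⟨_, rfl⟩
    obtain ⟨v, hv⟩ : ∃ v, v = r.takeWhile (fun x => !p x) := ⟨_, rfl⟩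
    obtain ⟨m2, hm2⟩ : ∃ m2, m2 = r.dropWhile (fun x => !p x) := ⟨_, rfl⟩
    have e1 : m = m1 ++ r := by rw [hm1, hr, List.takeWhile_append_dropWhile]
    have e2 : r = v ++ m2 := by rw [hv, hm2, List.takeWhile_append_dropWhile]
    have c1 : ∀ x ∈ m1, δ x.2 = κ := by
      intro x hx; rw [hm1] at hx
      simpa [p] using List.mem_takeWhile_imp hx
    have cv : ∀ x ∈ v, δ x.2 ≠ κ := by
      intro x hx; rw [hv] at hx
      simpa [p] using List.mem_takeWhile_imp hx
    have hrne : r ≠ [] := by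
      intro h; rw [h, List.append_nil] at e1
      exact hzκ (c1 z (e1 ▸ hz))
    have hvne : v ≠ [] := by
      cases r with
      | nil => exact absurd rfl hrne
      | cons x r' =>
        have hx : p x = false := by
          have := List.head?_dropWhile_not p m
          rw [← hr] at this
          simpa using this
        rw [hv]; simp [hx]
    have hx1 : X ++ m1 ≠ [] := by
      rcases hne with h | ⟨z, m', h, hz⟩
      · simp [h]
      · rw [hm1, h]; simp [p, hz]
    by_cases hcv : Closed v
    · exact ⟨X ++ m1, v, m2 ++ Y, by rw [hKm, e1, e2]; simp, hx1, hvne, hcv⟩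
    · -- the arch of `a` opens in `v` and closes in `m2`
      obtain ⟨a, ha⟩ : ∃ a, ¬ ((true, a) ∈ v ↔ (false, a) ∈ v) := by
        simpa [Closed] using hcv
      have hm_eq : m = m1 ++ (v ++ m2) := by rw [e1, e2]
      have haκ : δ a ≠ κ := by
        intro h
        exact ha ⟨fun h' => absurd h (cv _ h'), fun h' => absurd h (cv _ h')⟩
      have hboth := hcl a haκ
      have hnm1 : ∀ s, (s, a) ∉ m1 := fun s h => haκ (c1 _ h)
      simp only [hm_eq, List.mem_append, hnm1, false_or] at hboth
      have hTF : (true, a) ∈ v ∧ (false, a) ∈ m2 := by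
        by_cases hT : (true, a) ∈ v
        · refine ⟨hT, ?_⟩
          have := hboth.1 (Or.inl hT)
          tauto
        · have hF : (false, a) ∈ v := by tauto
          have hT2 : (true, a) ∈ m2 := by tauto
          exfalso
          refine hK.order a ?_
          have : [(false, a), (true, a)].Sublist (v ++ m2) :=
            (List.singleton_sublist.2 hF).append (List.singleton_sublist.2 hT2)
          rw [hKm, hm_eq]
          exact this.trans (((List.sublist_append_right m1 _).trans
            (List.sublist_append_right X _)).trans (List.sublist_append_left _ Y))
      obtain ⟨v1, v2, hv12⟩ := List.append_of_mem hTF.1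
      cases hm2c : m2 with
      | nil => rw [hm2c] at hTF; simp at hTF
      | cons h m2' =>
        have hh : δ h.2 = κ := by
          have := List.head?_dropWhile_not (fun x => !p x) r
          rw [← hm2, hm2c] at this
          simpa [p] using this
        have hFm : (false, a) ∈ m2' := by
          have := hTF.2
          rw [hm2c, List.mem_cons] at this
          rcases this with h' | h'
          · rw [← h'] at hh; exact absurd hh haκ
          · exact h'
        obtain ⟨w1, w2, hw12⟩ := List.append_of_mem hFm
        have hKe : K = ((X ++ m1 ++ v1) ++ [(true, a)]) ++ (v2 ++ h :: w1) ++
            ((false, a) :: (w2 ++ Y)) := by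
          rw [hKm, hm_eq, hv12, hm2c, hw12]; simp
        -- the letter `h` of class `κ` ends the run `v`, so it lies under the arch of `a`
        refine ih _ (v2 ++ h :: w1) _ (δ a) ?_ hKe ?_ (Or.inl (by simp)) ⟨h, by simp, ?_⟩
        · rw [hm_eq, hv12, hm2c, hw12] at hm
          simp at hm ⊢; omega
        · intro f hf
          have hfa : f ≠ a := fun h => hf (by rw [h])
          constructor
          · intro hT
            have hF : (false, f) ∈ K := (hK.closed f).1 (by
              rw [hKe]; exact List.mem_append_left _ (List.mem_append_right _ hT))
            rw [hKe, List.mem_append, List.mem_append] at hF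
            rcases hF with (hF | hF) | hF
            · exfalso
              refine hK.order f ?_
              rw [hKe]
              exact ((List.singleton_sublist.2 hF).append (List.singleton_sublist.2 hT)).trans
                (List.sublist_append_left _ _)
            · exact hF
            · exfalso
              have hF' : (false, f) ∈ w2 ++ Y := by
                rw [List.mem_cons] at hF
                rcases hF with hF | hF
                · exact absurd (congrArg Prod.snd hF) hfa
                · exact hF
              refine hf (hδ a f ?_).symm
              rw [hKe]
              change ([(true, a)] ++ [(true, f)] ++ ([(false, a), (false, f)])).Sublist _
              exact ((List.sublist_append_right _ _).append (List.singleton_sublist.2 hT)).append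
                ((List.singleton_sublist.2 hF').cons_cons _)
          · intro hF
            have hT : (true, f) ∈ K := (hK.closed f).2 (by
              rw [hKe]; exact List.mem_append_left _ (List.mem_append_right _ hF))
            rw [hKe, List.mem_append, List.mem_append] at hT
            rcases hT with (hT | hT) | hT
            · exfalso
              have hT' : (true, f) ∈ X ++ m1 ++ v1 := by
                rw [List.mem_append] at hT
                rcases hT with hT | hT
                · exact hT
                · simp at hT; exact absurd hT hfa
              refine hf (hδ f a ?_)
              rw [hKe]
              change ([(true, f)] ++ [(true, a)] ++ [(false, f)] ++ [(false, a)]).Sublist _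
              exact (((List.singleton_sublist.2 hT').append (List.Sublist.refl _)).append
                (List.singleton_sublist.2 hF)).append
                (List.singleton_sublist.2 (List.mem_cons_self))
            · exact hT
            · exfalso
              refine hK.order f ?_
              rw [hKe]
              exact ((List.singleton_sublist.2 hF).trans (List.sublist_append_right _ _)).append
                (List.singleton_sublist.2 hT)
        · rw [hh]; exact fun h => haκ h.symm

/-- Two colourings of a primitive arch system that agree on its first letter agree everywhere: arches
on which they agree do not cross arches on which they differ. -/
theorem Primitive.colouring_unique {K : List (Bool × α)} (hp : Primitive K) (hK : IsArch K)
    {c c' : α → Bool} (hc : NonCrossing c K) (hc' : NonCrossing c' K)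
    {z : Bool × α} {K' : List (Bool × α)} (hz : K = z :: K') (hcz : c z.2 = c' z.2) :
    ∀ x ∈ K, c x.2 = c' x.2 := by
  by_contra! hcon
  obtain ⟨y, hy, hyc⟩ := hcon
  obtain ⟨x, v, w, h, hx, hv, hcl⟩ := exists_closed_run hK (fun a => c a == c' a)
    (by
      intro a b hab
      have h1 : c a ≠ c b := fun h => hc a b h hab
      have h2 : c' a ≠ c' b := fun h => hc' a b h hab
      revert h1 h2
      cases c a <;> cases c b <;> cases c' a <;> cases c' b <;> simp)
    K.length [] K [] true le_rfl (by simp) (fun a _ => hK.closed a)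
    (Or.inr ⟨z, K', hz, by simp [hcz]⟩) ⟨y, hy, by simp [hyc]⟩
  exact hv (hp.2 x v w h hx hcl)

/-! ### Decomposition of a word into a primitive skeleton and its gaps -/

/-- The word obtained from the skeleton `k` by writing the `i`-th word of `gs` (the `i`-th gap) after
the `i`-th letter of `k`. Meaningful when the two lists have the same length. -/
def flat : List γ → List (List γ) → List γ
  | x :: k, g :: gs => x :: (g ++ flat k gs)
  | _, _ => []

@[simp] theorem flat_nil_left (gs : List (List γ)) : flat [] gs = [] := by simp [flat]
@[simp] theorem flat_cons (x : γ) (k : List γ) (g : List γ) (gs) :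
    flat (x :: k) (g :: gs) = x :: (g ++ flat k gs) := rfl

theorem map_flat {γ δ : Type*} (f : γ → δ) : ∀ (k : List γ) (gs : List (List γ)),
    (flat k gs).map f = flat (k.map f) (gs.map (List.map f))
  | x :: k, g :: gs => by simp [map_flat f k gs]
  | [], _ => by simp
  | _ :: _, [] => by simp [flat]

theorem flat_replicate_nil (k : List γ) : flat k (List.replicate k.length []) = k := by
  induction k with
  | nil => simp
  | cons x k ih => simp [List.replicate_succ, ih]

theorem sublist_flat : ∀ (k : List γ) (gs : List (List γ)), k.length = gs.length →
    k.Sublist (flat k gs)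
  | [], _, _ => by simp
  | x :: k, g :: gs, h => by
    rw [flat_cons]
    exact ((sublist_flat k gs (by simpa using h)).trans (List.sublist_append_right _ _)).cons_cons _

theorem mem_flat_of_gap : ∀ (k : List γ) (gs : List (List γ)), k.length = gs.length →
    ∀ g ∈ gs, ∀ x ∈ g, x ∈ flat k gs
  | [], gs, h, g, hg, _, _ => by
    have : gs = [] := List.length_eq_zero_iff.1 (by simpa using h.symm)
    simp [this] at hg
  | x :: k, g' :: gs, h, g, hg, y, hy => by
    rw [List.mem_cons] at hg
    rcases hg with rfl | hg
    · simp [hy]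
    · have := mem_flat_of_gap k gs (by simpa using h) g hg y hy
      simp [this]

theorem mem_flat : ∀ (k : List γ) (gs : List (List γ)) {y : γ}, y ∈ flat k gs →
    y ∈ k ∨ ∃ g ∈ gs, y ∈ g
  | [], gs, _, hy => by simp at hy
  | x :: k, [], _, hy => by simp [flat] at hy
  | x :: k, g :: gs, y, hy => by
    simp only [flat_cons, List.mem_cons, List.mem_append] at hy
    rcases hy with h | h | h
    · simp [h]
    · exact Or.inr ⟨g, by simp, h⟩
    · rcases mem_flat k gs h with h | ⟨g', hg', h⟩
      · simp [h]
      · exact Or.inr ⟨g', by simp [hg'], h⟩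

/-- A gap is a factor of the word, and it does not contain the first letter. -/
theorem flat_eq_of_gap : ∀ (k : List γ) (gs : List (List γ)), k.length = gs.length →
    ∀ g ∈ gs, ∃ x y, x ≠ [] ∧ flat k gs = x ++ g ++ y
  | [], gs, h, g, hg => by
    have : gs = [] := List.length_eq_zero_iff.1 (by simpa using h.symm)
    simp [this] at hg
  | x :: k, g' :: gs, h, g, hg => by
    rw [List.mem_cons] at hg
    rcases hg with rfl | hg
    · exact ⟨[x], flat k gs, by simp, by simp⟩
    · obtain ⟨x', y', -, e⟩ := flat_eq_of_gap k gs (by simpa using h) g hg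
      exact ⟨x :: (g' ++ x'), y', by simp, by simp [e]⟩

/-- A closed word inserted after the first letter can be absorbed by a gap. -/
theorem flat_insert : ∀ (k : List (Bool × α)) (gs : List (List (Bool × α))) (x v y),
    k.length = gs.length → (∀ g ∈ gs, Closed g) → Closed v → x ≠ [] → flat k gs = x ++ y →
    ∃ gs', k.length = gs'.length ∧ (∀ g ∈ gs', Closed g) ∧ flat k gs' = x ++ v ++ y
  | [], gs, x, v, y, _, _, _, hx, h => by simp at h; exact absurd h.1 hx
  | z :: k, g :: gs, x, v, y, hl, hg, hv, hx, h => by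
    obtain ⟨x0, x', rfl⟩ := List.exists_cons_of_ne_nil hx
    simp only [flat_cons, List.cons_append, List.cons.injEq] at h
    obtain ⟨rfl, h⟩ := h
    have hl' : k.length = gs.length := by simpa using hl
    have hgg : Closed g := hg g (by simp)
    have hgs : ∀ g ∈ gs, Closed g := fun g' h' => hg g' (by simp [h'])
    have key : ∀ g2, g = x' ++ g2 → y = g2 ++ flat k gs → ∃ gs', (z :: k).length = gs'.length ∧
        (∀ g ∈ gs', Closed g) ∧ flat (z :: k) gs' = z :: x' ++ v ++ y := by
      intro g2 h1 h2
      refine ⟨(x' ++ v ++ g2) :: gs, by simpa using hl', ?_, by simp [h2]⟩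
      intro g' hg'
      rw [List.mem_cons] at hg'
      rcases hg' with rfl | hg'
      · intro a
        have := hgg a
        rw [h1] at this
        simp only [List.mem_append] at this ⊢
        have := hv a
        tauto
      · exact hgs g' hg'
    rcases List.append_eq_append_iff.1 h with ⟨w, h1, h2⟩ | ⟨w, h1, h2⟩
    · by_cases hw : w = []
      · subst hw
        exact key [] (by simpa using h1.symm) (by simpa using h2.symm)
      · obtain ⟨gs', e1, e2, e3⟩ := flat_insert k gs w v y hl' hgs hv hw h2
        refine ⟨g :: gs', by simpa using e1, ?_, by simp [e3, h1]⟩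
        intro g' hg'
        rw [List.mem_cons] at hg'
        rcases hg' with rfl | hg'
        · exact hgg
        · exact e2 g' hg'
    · exact key w h1 h2

/-- Every nonempty word has a decomposition with a primitive skeleton and closed gaps: delete a closed
factor after the first letter, decompose the rest, and put the factor back into a gap. -/
theorem exists_primitive_flat (n : ℕ) : ∀ u : List (Bool × α), u.length ≤ n → u ≠ [] →
    ∃ k gs, k.length = gs.length ∧ Primitive k ∧ (∀ g ∈ gs, Closed g) ∧ flat k gs = u := by
  induction n with
  | zero => intro u hu hne; exact absurd (List.length_eq_zero_iff.1 (by omega)) hne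
  | succ n ih =>
    intro u hu hne
    by_cases hp : Primitive u
    · refine ⟨u, List.replicate u.length [], by simp, hp, ?_, flat_replicate_nil u⟩
      intro g hg
      rw [(List.mem_replicate.1 hg).2]
      exact Closed.nil
    · simp only [Primitive, ne_eq, hne, not_false_eq_true, true_and] at hp
      push Not at hp
      obtain ⟨x, v, y, hu', hx, hv, hv0⟩ := hp
      have hvl : 0 < v.length := List.length_pos_iff.2 hv0
      obtain ⟨k, gs, h1, h2, h3, h4⟩ := ih (x ++ y) (by rw [hu'] at hu; simp at hu ⊢; omega)
        (by simp [hx])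
      obtain ⟨gs', e1, e2, e3⟩ := flat_insert k gs x v y h1 h3 hv hx h4
      exact ⟨k, gs', e1, h2, e2, by rw [e3, hu']⟩

/-- The decomposition is determined by the word and by a property that holds for the letters of the
skeleton and fails in the gaps. -/
theorem flat_splitting_unique (p : γ → Prop) : ∀ (k : List γ) (gs : List (List γ)) (k' : List γ)
    (gs' : List (List γ)), k.length = gs.length → k'.length = gs'.length →
    (∀ x ∈ k, p x) → (∀ x ∈ k', p x) → (∀ g ∈ gs, ∀ x ∈ g, ¬ p x) →
    (∀ g ∈ gs', ∀ x ∈ g, ¬ p x) → flat k gs = flat k' gs' → k = k' ∧ gs = gs'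
  | [], gs, [], gs', h, h', _, _, _, _, _ => by
    simp at h h'
    simp [List.length_eq_zero_iff.1 h.symm, List.length_eq_zero_iff.1 h'.symm]
  | [], gs, x :: k', g' :: gs', h, h', _, _, _, _, e => by simp at e
  | x :: k, g :: gs, [], gs', h, h', _, _, _, _, e => by simp at e
  | x :: k, g :: gs, x' :: k', g' :: gs', h, h', hk, hk', hg, hg', e => by
    simp only [flat_cons, List.cons.injEq] at e
    obtain ⟨rfl, e⟩ := e
    have hl : k.length = gs.length := by simpa using h
    have hl' : k'.length = gs'.length := by simpa using h'
    have aux : ∀ (k : List γ) (gs) (k' : List γ) (gs') (g g' : List γ), k.length = gs.length →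
        (∀ x ∈ k, p x) → (∀ x ∈ g', ¬ p x) →
        ∀ w, g' = g ++ w → flat k gs = w ++ flat k' gs' → w = [] := by
      intro k gs k' gs' g g' hl hk hg' w h1 h2
      cases w with
      | nil => rfl
      | cons y w =>
        exfalso
        cases k with
        | nil => simp at h2
        | cons z k =>
          cases gs with
          | nil => simp at hl
          | cons g0 gs =>
            simp only [flat_cons, List.cons_append, List.cons.injEq] at h2
            refine hg' y (by simp [h1]) ?_
            rw [← h2.1]; exact hk z (by simp)
    have hgg : g = g' ∧ flat k gs = flat k' gs' := by
      rcases List.append_eq_append_iff.1 e with ⟨w, h1, h2⟩ | ⟨w, h1, h2⟩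
      · have := aux k gs k' gs' g g' hl (fun x hx => hk x (by simp [hx]))
          (hg' g' (by simp)) w h1 h2
        subst this
        simp_all
      · have := aux k' gs' k gs g' g hl' (fun x hx => hk' x (by simp [hx]))
          (hg g (by simp)) w h1 h2
        subst this
        simp_all
    obtain ⟨h1, h2⟩ := flat_splitting_unique p k gs k' gs' hl hl'
      (fun x hx => hk x (by simp [hx])) (fun x hx => hk' x (by simp [hx]))
      (fun g h => hg g (by simp [h])) (fun g h => hg' g (by simp [h])) hgg.2
    simp [hgg.1, h1, h2]

theorem head_flat {x : γ} {k : List γ} {gs : List (List γ)} (h : (x :: k).length = gs.length) :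
    ∃ r, flat (x :: k) gs = x :: r := by
  cases gs with
  | nil => simp at h
  | cons g gs => exact ⟨_, flat_cons ..⟩

theorem flat_nodup_disjoint : ∀ (k : List γ) (gs : List (List γ)), k.length = gs.length →
    (flat k gs).Nodup → ∀ g ∈ gs, ∀ x ∈ g, x ∉ k
  | [], _, _, _, _, _, _, _ => by simp
  | z :: k, g' :: gs, h, hn, g, hg, x, hx => by
    have hl : k.length = gs.length := by simpa using h
    rw [flat_cons, List.nodup_cons, List.nodup_append] at hn
    obtain ⟨hz, hn1, hn2, hd⟩ := hn
    rw [List.mem_cons] at hg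
    rcases hg with rfl | hg
    · intro hxk
      rw [List.mem_cons] at hxk
      rcases hxk with rfl | hxk
      · exact hz (by simp [hx])
      · exact hd x hx x ((sublist_flat k gs hl).subset hxk) rfl
    · intro hxk
      rw [List.mem_cons] at hxk
      rcases hxk with rfl | hxk
      · exact hz (by simp [mem_flat_of_gap k gs hl g hg x hx])
      · exact flat_nodup_disjoint k gs hl hn2 g hg x hx hxk

/-- The gaps of one decomposition do not meet the skeleton `k'` of another: the part of `k'` that lies
in a gap is a closed factor of `k'` after its first letter, hence empty. -/
theorem gap_disjoint_of_primitive {k k' : List (Bool × α)} {gs gs' : List (List (Bool × α))}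
    (hl : k.length = gs.length) (hl' : k'.length = gs'.length)
    (hu : (flat k gs).Nodup) (hp : Primitive k)
    (hp' : Primitive k') (hg : ∀ g ∈ gs, Closed g) (hg' : ∀ g ∈ gs', Closed g)
    (e : flat k gs = flat k' gs') : ∀ g ∈ gs, ∀ x ∈ g, x.2 ∉ k'.map Prod.snd := by
  classical
  let p : Bool × α → Bool := fun x => decide (x.2 ∈ k'.map Prod.snd)
  -- filtering by the labels of `k'` recovers `k'`
  have hgap : ∀ g ∈ gs', ∀ x ∈ g, p x = false := by
    intro g h x hx
    simp only [p, decide_eq_false_iff_not, List.mem_map, not_exists, not_and]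
    rintro ⟨s, a⟩ hs rfl
    refine flat_nodup_disjoint k' gs' hl' (e ▸ hu) g h (s, x.2) ?_ hs
    exact ((hg' g h).mem_iff x.1 s x.2).1 hx
  have hfilter : ∀ (k : List (Bool × α)) (gs : List (List (Bool × α))), k.length = gs.length →
      (∀ x ∈ k, p x = true) → (∀ g ∈ gs, ∀ x ∈ g, p x = false) → (flat k gs).filter p = k := by
    intro k
    induction k with
    | nil => simp
    | cons z k ih =>
      intro gs hl h1 h2
      cases gs with
      | nil => simp at hl
      | cons g gs =>
        rw [flat_cons, List.filter_cons, if_pos (h1 z (by simp)), List.filter_append,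
          ih gs (by simpa using hl) (fun x hx => h1 x (by simp [hx]))
            (fun g h => h2 g (by simp [h])), List.filter_eq_nil_iff.2]
        · simp
        · intro x hx; simp [h2 g (by simp) x hx]
  have hk' : (flat k' gs').filter p = k' := hfilter k' gs' hl'
    (fun x hx => by simp only [p, decide_eq_true_eq]; exact List.mem_map_of_mem hx) hgap
  intro g h x hx hxk
  obtain ⟨X, Y, hX, hXY⟩ := flat_eq_of_gap k gs hl g h
  rw [← e, hXY, List.filter_append, List.filter_append] at hk'
  have hfX : X.filter p ≠ [] := by
    obtain ⟨z, k1, rfl⟩ := List.exists_cons_of_ne_nil hp.1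
    obtain ⟨z', k1', rfl⟩ := List.exists_cons_of_ne_nil hp'.1
    obtain ⟨r, hr⟩ := head_flat hl
    obtain ⟨r', hr'⟩ := head_flat hl'
    obtain ⟨y, X', rfl⟩ := List.exists_cons_of_ne_nil hX
    have hzz : z = z' := by rw [hr, hr'] at e; exact (List.cons.inj e).1
    have hzy : z = y := by rw [hr] at hXY; exact (List.cons.inj hXY).1
    have : p y = true := by simp [p, ← hzy, hzz]
    simp [this]
  have hcl : Closed (g.filter p) := by
    intro a
    simp only [List.mem_filter]
    rw [hg g h a]
  have := hp'.2 _ _ _ hk'.symm hfX hcl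
  rw [List.filter_eq_nil_iff] at this
  exact this x hx (by simpa [p] using hxk)

/-- The primitive skeleton and the closed gaps of a word without repeated letters are unique. -/
theorem flat_primitive_unique {k k' : List (Bool × α)} {gs gs' : List (List (Bool × α))}
    (hl : k.length = gs.length) (hl' : k'.length = gs'.length)
    (hu : (flat k gs).Nodup) (hp : Primitive k)
    (hp' : Primitive k') (hg : ∀ g ∈ gs, Closed g) (hg' : ∀ g ∈ gs', Closed g)
    (e : flat k gs = flat k' gs') : k = k' ∧ gs = gs' := by
  have h1 := gap_disjoint_of_primitive hl hl' hu hp hp' hg hg' e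
  have h2 := gap_disjoint_of_primitive hl' hl (e ▸ hu) hp' hp hg' hg e.symm
  refine flat_splitting_unique (fun x => x ∈ k') k gs k' gs' hl hl' ?_ (fun x hx => hx) ?_ ?_ e
  · intro x hx
    have hx' : x ∈ flat k' gs' := e ▸ (sublist_flat k gs hl).subset hx
    rcases mem_flat k' gs' hx' with h | ⟨g, hg, h⟩
    · exact h
    · exact absurd (List.mem_map_of_mem hx) (h2 g hg x h)
  · intro g h x hx hxk
    exact h1 g h x hx (List.mem_map_of_mem hxk)
  · intro g h x hx
    exact flat_nodup_disjoint k' gs' hl' (e ▸ hu) g h x hx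

/-! ### Arch systems as computations of the machine -/

open Classical in
/-- The contents of the stack `col`, top first, after the operations `z`: the labels of this colour
that have been pushed and not yet popped. -/
noncomputable def live (c : α → Bool) (z : List (Bool × α)) (col : Bool) : List α :=
  ((pushes z).filter fun a => decide (c a = col ∧ (false, a) ∉ z)).reverse

theorem live_push {c : α → Bool} {z : List (Bool × α)} {a : α} (h : (false, a) ∉ z) (col : Bool) :
    live c (z ++ [(true, a)]) col = if c a = col then a :: live c z col else live c z col := by
  classical
  have e : ∀ x, ((false, x) ∉ z ++ [(true, a)]) ↔ (false, x) ∉ z := by intro x; simp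
  unfold live
  simp only [pushes_append, pushes_cons_true, pushes_nil, List.filter_append, List.reverse_append, e]
  by_cases hc : c a = col <;> simp [hc, h]

/-- The label that is popped next is on top of its stack; otherwise the arch of a label above it would
cross its arch. -/
theorem live_pop {c : α → Bool} {z r : List (Bool × α)} {a : α}
    (hu : IsArch (z ++ (false, a) :: r)) (hc : NonCrossing c (z ++ (false, a) :: r)) (col : Bool) :
    live c z col = if c a = col then a :: live c (z ++ [(false, a)]) col
      else live c (z ++ [(false, a)]) col := by
  classical
  have hTa : (true, a) ∈ z := by
    have : (true, a) ∈ z ++ (false, a) :: r := (hu.closed a).2 (by simp)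
    rw [List.mem_append, List.mem_cons] at this
    rcases this with h | h | h
    · exact h
    · simp at h
    · exfalso
      refine hu.order a ?_
      exact (((List.singleton_sublist.2 h).cons_cons _)).trans (List.sublist_append_right _ _)
  have hFa : (false, a) ∉ z := by
    intro h
    have := List.nodup_append.1 hu.nodup
    exact this.2.2 _ h _ List.mem_cons_self rfl
  obtain ⟨z1, z2, rfl⟩ := List.append_of_mem hTa
  have hz1 : ∀ x ∈ pushes z1, x ≠ a := by
    rintro x hx rfl
    rw [mem_pushes] at hx
    have h1 := (List.nodup_append.1 (List.nodup_append.1 hu.nodup).1).2.2 _ hx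
    exact h1 _ List.mem_cons_self rfl
  have hz2 : ∀ x ∈ pushes z2, c x = c a → (false, x) ∈ z1 ++ (true, a) :: z2 := by
    intro x hx hcx
    by_contra hF
    rw [mem_pushes] at hx
    have hxa : x ≠ a := by
      rintro rfl
      have h1 := (List.nodup_append.1 (List.nodup_append.1 hu.nodup).1).2.1
      exact (List.nodup_cons.1 h1).1 hx
    have hFr : (false, x) ∈ r := by
      have h2 : (false, x) ∈ (z1 ++ (true, a) :: z2) ++ (false, a) :: r :=
        (hu.closed x).1 (by simp [hx])
      rw [List.mem_append, List.mem_cons] at h2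
      rcases h2 with h2 | h2 | h2
      · exact absurd h2 hF
      · simp at h2; exact absurd h2 hxa
      · exact h2
    refine hc a x hcx.symm ?_
    change ([(true, a), (true, x)] ++ [(false, a), (false, x)]).Sublist _
    refine List.Sublist.append ?_ ((List.singleton_sublist.2 hFr).cons_cons _)
    exact ((List.singleton_sublist.2 hx).cons_cons _).trans (List.sublist_append_right _ _)
  unfold live
  by_cases hca : c a = col
  · subst hca
    have e1 : (pushes z2).filter (fun x => decide (c x = c a ∧
        (false, x) ∉ z1 ++ (true, a) :: z2)) = [] := by
      rw [List.filter_eq_nil_iff]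
      intro x hx
      simp only [decide_eq_true_eq, not_and, not_not]
      exact hz2 x hx
    have e2 : (pushes z2).filter (fun x => decide (c x = c a ∧
        (false, x) ∉ z1 ++ (true, a) :: z2 ++ [(false, a)])) = [] := by
      rw [List.filter_eq_nil_iff]
      intro x hx
      simp only [decide_eq_true_eq, not_and, not_not]
      intro h
      exact List.mem_append_left _ (hz2 x hx h)
    have e3 : (pushes z1).filter (fun x => decide (c x = c a ∧
        (false, x) ∉ z1 ++ (true, a) :: z2 ++ [(false, a)])) =
        (pushes z1).filter (fun x => decide (c x = c a ∧ (false, x) ∉ z1 ++ (true, a) :: z2)) := by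
      refine List.filter_congr ?_
      intro x hx
      have := hz1 x hx
      simp [this]
    rw [if_pos rfl]
    simp only [pushes_append, pushes_cons_true, pushes_cons_false, pushes_nil, List.append_nil,
      List.filter_append, List.filter_cons, e1, e2, e3]
    simp at hFa
    simp [hFa]
  · rw [if_neg hca]
    congr 1
    simp only [pushes_append, pushes_cons_false, pushes_nil, List.append_nil]
    refine List.filter_congr ?_
    intro x hx
    by_cases hxa : x = a
    · subst hxa; simp [hca]
    · simp [hxa]

theorem IsArch.steps_from {c : α → Bool} {u : List (Bool × α)} (hu : IsArch u)
    (hc : NonCrossing c u) : ∀ r z, u = z ++ r → Relation.ReflTransGen Step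
      ⟨pushes r, live c z false, live c z true, pops z⟩ ⟨[], [], [], pops u⟩
  | [], z, h => by
    have hz : ∀ col, live c z col = [] := by
      intro col
      unfold live
      rw [List.reverse_eq_nil_iff, List.filter_eq_nil_iff]
      intro a ha
      rw [mem_pushes] at ha
      have := (hu.closed a).1 (by rw [h]; simpa using ha)
      rw [h, List.append_nil] at this
      simp [this]
    rw [hz, hz, h, List.append_nil]
    exact Relation.ReflTransGen.refl
  | (true, a) :: r, z, h => by
    have hF : (false, a) ∉ z := by
      intro hF
      refine hu.order a ?_
      rw [h]
      exact (List.singleton_sublist.2 hF).append (List.singleton_sublist.2 (by simp))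
    have ih := IsArch.steps_from hu hc r (z ++ [(true, a)]) (by simp [h])
    rw [live_push hF, live_push hF] at ih
    refine Relation.ReflTransGen.head ?_ ih
    cases hca : c a
    · simpa using Step.in₁ a (pushes r) (live c z false) (live c z true) (pops z)
    · simpa using Step.in₂ a (pushes r) (live c z false) (live c z true) (pops z)
  | (false, a) :: r, z, h => by
    have ih := IsArch.steps_from hu hc r (z ++ [(false, a)]) (by simp [h])
    have hp := live_pop (h ▸ hu) (h ▸ hc)
    rw [hp false, hp true]
    refine Relation.ReflTransGen.head ?_ ih
    cases hca : c a
    · simpa using Step.out₁ a (pushes r) (live c (z ++ [(false, a)]) false)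
        (live c (z ++ [(false, a)]) true) (pops z)
    · simpa using Step.out₂ a (pushes r) (live c (z ++ [(false, a)]) false)
        (live c (z ++ [(false, a)]) true) (pops z)

/-- The machine carries out a coloured arch system without crossings. -/
theorem IsArch.steps {c : α → Bool} {u : List (Bool × α)} (hu : IsArch u)
    (hc : NonCrossing c u) : Relation.ReflTransGen Step
      ⟨pushes u, [], [], []⟩ ⟨[], [], [], pops u⟩ := by
  simpa [live] using hu.steps_from hc u [] rfl

/-! ### Sortable words and the generating function -/

theorem Step.map (f : α → β) {x y : TwoStacks α} (h : Step x y) :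
    Step ⟨x.input.map f, x.stack₁.map f, x.stack₂.map f, x.output.map f⟩
      ⟨y.input.map f, y.stack₁.map f, y.stack₂.map f, y.output.map f⟩ := by
  cases h <;> simp only [List.map_cons, List.map_append, List.map_nil] <;> constructor

theorem steps_map (f : α → β) {x y : TwoStacks α} (h : Relation.ReflTransGen Step x y) :
    Relation.ReflTransGen Step
      ⟨x.input.map f, x.stack₁.map f, x.stack₂.map f, x.output.map f⟩
      ⟨y.input.map f, y.stack₁.map f, y.stack₂.map f, y.output.map f⟩ :=
  h.lift (fun x : TwoStacks α => (⟨x.input.map f, x.stack₁.map f, x.stack₂.map f,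
    x.output.map f⟩ : TwoStacks β)) fun _ _ => Step.map f

/-- An operation remains possible with more input, more at the bottom of the stacks, and an earlier
output. -/
theorem Step.frame (i s₁ s₂ o : List α) {x y : TwoStacks α} (h : Step x y) :
    Step ⟨x.input ++ i, x.stack₁ ++ s₁, x.stack₂ ++ s₂, o ++ x.output⟩
      ⟨y.input ++ i, y.stack₁ ++ s₁, y.stack₂ ++ s₂, o ++ y.output⟩ := by
  cases h <;> simp only [List.cons_append, ← List.append_assoc] <;> constructor

theorem steps_frame (i s₁ s₂ o : List α) {x y : TwoStacks α} (h : Relation.ReflTransGen Step x y) :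
    Relation.ReflTransGen Step
      ⟨x.input ++ i, x.stack₁ ++ s₁, x.stack₂ ++ s₂, o ++ x.output⟩
      ⟨y.input ++ i, y.stack₁ ++ s₁, y.stack₂ ++ s₂, o ++ y.output⟩ :=
  h.lift (fun x : TwoStacks α => (⟨x.input ++ i, x.stack₁ ++ s₁, x.stack₂ ++ s₂,
    o ++ x.output⟩ : TwoStacks α)) fun _ _ => Step.frame i s₁ s₂ o

theorem steps_perm {x y : TwoStacks α} (h : Relation.ReflTransGen Step x y) :
    (x.input ++ x.stack₁ ++ x.stack₂ ++ x.output).Perm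
      (y.input ++ y.stack₁ ++ y.stack₂ ++ y.output) := by
  classical
  induction h with
  | refl => exact List.Perm.refl _
  | tail _ h ih =>
    refine ih.trans ?_
    cases h <;> (rw [List.perm_iff_count]; intro a; simp [List.count_cons]; try omega)

/-- The machine turns the word `l` into `0 1 ⋯ n-1`, where `n` is the length of `l`. This is
`Sortable` for permutations written as lists of natural numbers. -/
def Sorts (l : List ℕ) : Prop :=
  Relation.ReflTransGen Step ⟨l, [], [], []⟩ ⟨[], [], [], List.range l.length⟩

theorem Sorts.perm {l : List ℕ} (h : Sorts l) : l.Perm (List.range l.length) := by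
  simpa using steps_perm h

theorem sorts_map_ofFn {n : ℕ} (σ : Equiv.Perm (Fin n)) :
    Sorts ((List.ofFn σ).map Fin.val) ↔ Sortable σ := by
  have e : (List.finRange n).map Fin.val = List.range n := List.map_coe_finRange_eq_range
  unfold Sorts Sortable
  constructor
  · intro h
    rcases n with _ | n
    · simp only [List.ofFn_zero, List.finRange_zero]
      exact Relation.ReflTransGen.refl
    · have h' := steps_map (Fin.ofNat (n + 1)) h
      have hid : (Fin.ofNat (n + 1)) ∘ Fin.val = (id : Fin (n + 1) → Fin (n + 1)) := by
        funext x; simp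
      simp only [List.map_map, hid, List.map_id, List.map_nil, List.length_map,
        List.length_ofFn] at h'
      rw [← e, List.map_map, hid, List.map_id] at h'
      exact h'
  · intro h
    have h' := steps_map Fin.val h
    simpa [e] using h'

theorem Sorts.exists_perm {l : List ℕ} (h : Sorts l) :
    ∃ σ : Equiv.Perm (Fin l.length), (List.ofFn σ).map Fin.val = l := by
  have hp := h.perm
  have hlt : ∀ i : Fin l.length, l[i] < l.length := by
    intro i
    have : l[i] ∈ List.range l.length := hp.subset (List.getElem_mem i.2)
    simpa using this
  have hn : l.Nodup := hp.nodup_iff.2 List.nodup_range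
  let f : Fin l.length → Fin l.length := fun i => ⟨l[i], hlt i⟩
  have hf : Function.Injective f := by
    intro i j hij
    have : l[i] = l[j] := congrArg Fin.val hij
    exact Fin.ext ((List.Nodup.getElem_inj_iff hn).1 this)
  refine ⟨Equiv.ofBijective f ((Finite.injective_iff_bijective).1 hf), ?_⟩
  rw [List.map_ofFn]
  conv_rhs => rw [← List.ofFn_getElem (xs := l)]
  rfl

open Classical in
/-- The generating function of the sortable words, with values in `[0, ∞]`; by `genFun_eq` it is
`∑ p_n x^n`. -/
noncomputable def genFun (x : ℝ≥0∞) : ℝ≥0∞ := ∑' l : List ℕ, if Sorts l then x ^ l.length else 0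

theorem genFun_eq (x : ℝ≥0∞) : genFun x = ∑' n, (count n : ℝ≥0∞) * x ^ n := by
  classical
  let i : (Σ n, {σ : Equiv.Perm (Fin n) // Sortable σ}) → List ℕ :=
    fun p => (List.ofFn p.2.1).map Fin.val
  have hi : Function.Injective i := by
    rintro ⟨n, σ, hσ⟩ ⟨m, τ, hτ⟩ h
    have hnm : n = m := by simpa [i] using congrArg List.length h
    subst hnm
    have : σ = τ := by
      have h2 := (List.map_injective_iff.2 Fin.val_injective) h
      exact Equiv.coe_fn_injective (List.ofFn_injective h2)
    subst this; rfl
  unfold genFun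
  rw [← hi.tsum_eq, ENNReal.tsum_sigma']
  · congr 1
    funext n
    have : ∀ b : {σ : Equiv.Perm (Fin n) // Sortable σ},
        (if Sorts (i ⟨n, b⟩) then x ^ (i ⟨n, b⟩).length else 0) = x ^ n := by
      intro b
      rw [if_pos ((sorts_map_ofFn b.1).2 b.2)]
      simp [i]
    simp only [this]
    rw [tsum_fintype, Finset.sum_const, count, Nat.card_eq_fintype_card, nsmul_eq_mul,
      Finset.card_univ]
  · intro l hl
    have hl' : Sorts l := by
      by_contra h
      simp [h] at hl
    obtain ⟨σ, hσ⟩ := hl'.exists_perm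
    exact ⟨⟨l.length, σ, (sorts_map_ofFn σ).1 (by rw [hσ]; exact hl')⟩, hσ⟩

/-- While the first letter waits at the bottom of a stack, the machine can sort `l` above it. -/
theorem Sorts.cons_append {l l' : List ℕ} (h : Sorts l) (h' : Sorts l') :
    Sorts (l.length :: (l ++ l'.map (· + (l.length + 1)))) := by
  unfold Sorts at *
  have h1 := steps_frame (l'.map (· + (l.length + 1))) [l.length] [] [] h
  have h2 := steps_frame [] [] [] (List.range (l.length + 1)) (steps_map (· + (l.length + 1)) h')
  simp only [List.nil_append, List.append_nil, List.map_nil] at h1 h2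
  refine Relation.ReflTransGen.head (Step.in₁ _ _ _ _ _) (h1.trans ?_)
  refine Relation.ReflTransGen.head (Step.out₁ _ _ _ _ _) ?_
  rw [← List.range_succ]
  have : List.range (l.length :: (l ++ l'.map (· + (l.length + 1)))).length =
      List.range (l.length + 1) ++ (List.range l'.length).map (· + (l.length + 1)) := by
    rw [show (l.length :: (l ++ l'.map (· + (l.length + 1)))).length =
      (l.length + 1) + l'.length by simp; omega, List.range_add]
    congr 2
    funext x; omega
  rw [this]
  exact h2

/-- Comparison of sums along a map that is injective where the smaller summand does not vanish. -/
theorem tsum_le_tsum_of_injOn {X Y : Type*} {f : X → ℝ≥0∞} {g : Y → ℝ≥0∞} (Φ : X → Y)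
    (hinj : ∀ x y, f x ≠ 0 → f y ≠ 0 → Φ x = Φ y → x = y) (hle : ∀ x, f x ≠ 0 → f x ≤ g (Φ x)) :
    ∑' x, f x ≤ ∑' y, g y := by
  rw [← tsum_subtype_support f]
  refine le_trans (ENNReal.tsum_le_tsum fun x : Function.support f => hle x.1 x.2) ?_
  exact ENNReal.tsum_comp_le_tsum_of_injective (f := fun x : Function.support f => Φ x.1)
    (fun x y h => Subtype.ext (hinj _ _ x.2 y.2 h)) g

open Classical in
theorem genFun_eq_one_add (x : ℝ≥0∞) : genFun x =
    1 + ∑' l : List ℕ, if l = [] then 0 else if Sorts l then x ^ l.length else 0 := by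
  have h4 : Sorts [] := Relation.ReflTransGen.refl
  unfold genFun
  rw [ENNReal.tsum_eq_add_tsum_ite ([] : List ℕ), if_pos h4, List.length_nil, pow_zero]
  refine congrArg (fun y : ℝ≥0∞ => 1 + y) (tsum_congr fun l => ?_)
  by_cases h : l = [] <;> simp [h]

/-- The words `l.length :: (l ++ l')`, with `l'` shifted, are sortable and determine `l` and `l'`. This
gives a bound on `P` that does not degenerate at the radius of convergence. -/
theorem genFun_mul_le (x : ℝ≥0∞) : 1 + x * genFun x ^ 2 ≤ genFun x := by
  classical
  let F : List ℕ → ℝ≥0∞ := fun l => if Sorts l then x ^ l.length else 0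
  have h1 : x * genFun x ^ 2 = ∑' p : List ℕ × List ℕ, x * (F p.1 * F p.2) := by
    rw [ENNReal.tsum_prod (f := fun a b => x * (F a * F b))]
    simp only [ENNReal.tsum_mul_left, ENNReal.tsum_mul_right]
    rw [sq]; rfl
  have h2 : ∑' p : List ℕ × List ℕ, x * (F p.1 * F p.2) ≤
      ∑' l : List ℕ, if l = [] then 0 else F l := by
    refine tsum_le_tsum_of_injOn
      (fun p => p.1.length :: (p.1 ++ p.2.map (· + (p.1.length + 1)))) ?_ ?_
    · rintro ⟨a, b⟩ ⟨a', b'⟩ - - h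
      simp only [List.cons.injEq] at h
      obtain ⟨h1, h2⟩ := h
      obtain ⟨h3, h4⟩ := List.append_inj h2 h1
      rw [h1] at h4
      have := (List.map_injective_iff.2 (add_left_injective (a'.length + 1))) h4
      rw [h3, this]
    · rintro ⟨a, b⟩ h
      have ha : Sorts a := by
        by_contra hh; simp [F, hh] at h
      have hb : Sorts b := by
        by_contra hh; simp [F, hh] at h
      simp only [F, if_pos ha, if_pos hb, if_pos (ha.cons_append hb), reduceCtorEq, if_false]
      apply le_of_eq
      simp only [List.length_cons, List.length_append, List.length_map]
      ring
  rw [h1]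
  conv_rhs => rw [genFun_eq_one_add]
  gcongr

/-! ### Words that pop as early as possible -/

/-- If every pop that follows a push immediately takes the letter just pushed, then the first letter
popped by a word that begins with a push has been pushed before. -/
theorem true_mem_of_pops_eq_cons {u : List (Bool × α)} {a : α} {l : List α} {i : α}
    (hg : ∀ p x y r, (true, i) :: u = p ++ (true, x) :: (false, y) :: r → x = y)
    (h : pops u = a :: l) : (true, a) ∈ (true, i) :: u := by
  induction u generalizing i with
  | nil => simp at h
  | cons z u ih =>
    obtain ⟨_ | _, j⟩ := z
    · simp only [pops_cons_false, List.cons.injEq] at h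
      have := hg [] i j u rfl
      simp [this, h.1]
    · rw [pops_cons_true] at h
      refine List.mem_cons_of_mem _ (ih ?_ h)
      intro p x y r e
      exact hg ((true, i) :: p) x y r (by simp [e])

/-- A word in which a pop directly after a push always takes the letter just pushed is determined by
its sequences of pushes and pops. Thus different such arch systems sort different permutations. -/
theorem eq_of_pushes_eq_of_pops_eq {u u' : List (Bool × α)}
    (hg : ∀ p x y r, u = p ++ (true, x) :: (false, y) :: r → x = y)
    (hg' : ∀ p x y r, u' = p ++ (true, x) :: (false, y) :: r → x = y)
    (ho : ∀ a, ¬ [(false, a), (true, a)].Sublist u)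
    (ho' : ∀ a, ¬ [(false, a), (true, a)].Sublist u')
    (h1 : pushes u = pushes u') (h2 : pops u = pops u') : u = u' := by
  induction u generalizing u' with
  | nil =>
    cases u' with
    | nil => rfl
    | cons z u' => obtain ⟨_ | _, j⟩ := z <;> simp at h1 h2
  | cons z u ih =>
    cases u' with
    | nil => obtain ⟨_ | _, j⟩ := z <;> simp at h1 h2
    | cons z' u' =>
      have key : ∀ (u u' : List (Bool × α)) (i a : α),
          (∀ p x y r, (true, i) :: u = p ++ (true, x) :: (false, y) :: r → x = y) →
          (∀ a', ¬ [(false, a'), (true, a')].Sublist ((false, a) :: u')) →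
          pushes ((true, i) :: u) = pushes ((false, a) :: u') →
          pops ((true, i) :: u) = pops ((false, a) :: u') → False := by
        intro u u' i a hg ho h1 h2
        have h3 := true_mem_of_pops_eq_cons hg h2
        rw [← mem_pushes, h1, pushes_cons_false, mem_pushes] at h3
        exact ho a ((List.singleton_sublist.2 h3).cons_cons _)
      have hrec : (z = z') → (pushes u = pushes u') → (pops u = pops u') → (z :: u = z' :: u') := by
        rintro rfl h1 h2
        congr 1
        refine ih ?_ ?_ ?_ ?_ h1 h2
        · exact fun p x y r e => hg (z :: p) x y r (by simp [e])
        · exact fun p x y r e => hg' (z :: p) x y r (by simp [e])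
        · exact fun a h => ho a (h.trans (List.sublist_cons_self _ _))
        · exact fun a h => ho' a (h.trans (List.sublist_cons_self _ _))
      obtain ⟨_ | _, i⟩ := z <;> obtain ⟨_ | _, j⟩ := z'
      · simp only [pops_cons_false, List.cons.injEq, pushes_cons_false] at h1 h2
        exact hrec (by rw [h2.1]) h1 h2.2
      · exact (key u' u j i hg' ho h1.symm h2.symm).elim
      · exact (key u u' i j hg ho' h1 h2).elim
      · simp only [pops_cons_true, List.cons.injEq, pushes_cons_true] at h1 h2
        exact hrec (by rw [h1.1]) h1.2 h2

/-! ### Weights of words -/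

open Classical in
/-- The weight of two consecutive letters: a pop right after a push counts `b` when the two letters
have the same label (or colour) and `0` otherwise; all other pairs count `1`. -/
noncomputable def wtStep (b : ℝ≥0∞) (x y : Bool × α) : ℝ≥0∞ :=
  if x.1 = true ∧ y.1 = false then (if x.2 = y.2 then b else 0) else 1

/-- The product of the weights of consecutive letters. It vanishes unless every pop right after a push
belongs to the same label (or colour), and then it is `b` to the number of such pairs. -/
noncomputable def wt (b : ℝ≥0∞) : List (Bool × α) → ℝ≥0∞
  | x :: y :: r => wtStep b x y * wt b (y :: r)
  | _ => 1

@[simp] theorem wt_nil (b : ℝ≥0∞) : wt b ([] : List (Bool × α)) = 1 := by simp [wt]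
@[simp] theorem wt_singleton (b : ℝ≥0∞) (x : Bool × α) : wt b [x] = 1 := by simp [wt]
theorem wt_cons_cons (b : ℝ≥0∞) (x y : Bool × α) (r) :
    wt b (x :: y :: r) = wtStep b x y * wt b (y :: r) := by simp [wt]

theorem wtStep_false (b : ℝ≥0∞) {x : Bool × α} (y : Bool × α) (h : x.1 = false) :
    wtStep b x y = 1 := by simp [wtStep, h]
theorem wtStep_true (b : ℝ≥0∞) (x : Bool × α) {y : Bool × α} (h : y.1 = true) :
    wtStep b x y = 1 := by simp [wtStep, h]

theorem wt_one_le_one (u : List (Bool × α)) : wt 1 u ≤ 1 := by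
  match u with
  | [] => simp
  | [x] => simp
  | x :: y :: r =>
    rw [wt_cons_cons]
    refine mul_le_one' ?_ (wt_one_le_one _)
    unfold wtStep
    split_ifs <;> simp

theorem wt_ne_zero {b : ℝ≥0∞} {u : List (Bool × α)} (h : wt b u ≠ 0) :
    ∀ p x y r, u = p ++ (true, x) :: (false, y) :: r → x = y := by
  intro p
  induction p generalizing u with
  | nil =>
    rintro x y r rfl
    by_contra hxy
    rw [List.nil_append, wt_cons_cons] at h
    simp [wtStep, hxy] at h
  | cons z p ih =>
    rintro x y r rfl
    refine ih (u := p ++ (true, x) :: (false, y) :: r) ?_ x y r rfl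
    intro h0
    apply h
    rw [List.cons_append]
    cases hp : p ++ (true, x) :: (false, y) :: r with
    | nil => simp at hp
    | cons z' r' => rw [wt_cons_cons, ← hp, h0, mul_zero]

theorem wt_append (b : ℝ≥0∞) (u : List (Bool × α)) (x y : Bool × α) (v : List (Bool × α)) :
    wt b (u ++ x :: y :: v) = wt b (u ++ [x]) * wtStep b x y * wt b (y :: v) := by
  match u with
  | [] => simp [wt_cons_cons]
  | [z] => simp [wt_cons_cons, mul_assoc]
  | z :: z' :: u =>
    have := wt_append b (z' :: u) x y v
    simp only [List.cons_append] at this ⊢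
    rw [wt_cons_cons, this, wt_cons_cons]
    ring

theorem wt_append_of_false (b : ℝ≥0∞) (u : List (Bool × α)) (a : α) (v : List (Bool × α)) :
    wt b (u ++ (false, a) :: v) = wt b (u ++ [(false, a)]) * wt b v := by
  cases v with
  | nil => simp
  | cons y v => rw [wt_append, wtStep_false _ _ rfl, mul_one]

theorem wt_append_of_true (b : ℝ≥0∞) (u : List (Bool × α)) (a : α) (v : List (Bool × α)) :
    wt b (u ++ (true, a) :: v) = wt b u * wt b ((true, a) :: v) := by
  rcases List.eq_nil_or_concat u with rfl | ⟨u, x, rfl⟩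
  · simp
  · rw [List.concat_eq_append, List.append_assoc, List.singleton_append, wt_append, wtStep_true _ _ rfl, mul_one]

/-- The weight of a word with a factor `s` for each letter, so that `s ^ 2` marks an arch. -/
noncomputable def wts (s b : ℝ≥0∞) (u : List (Bool × α)) : ℝ≥0∞ := s ^ u.length * wt b u

/-- The total weight of the words with skeleton `k`, apart from the factors `s` of `k`, when the
nonempty gap words have total weight `q`. An empty gap counts as the pair of letters it separates,
and the gap after the last letter counts `1` if empty. -/
noncomputable def gapProd (b q : ℝ≥0∞) : List (Bool × α) → ℝ≥0∞
  | x :: y :: r => (wtStep b x y + q) * gapProd b q (y :: r)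
  | [_] => 1 + q
  | [] => 1

/-- The weight of the gaps `gs` of the skeleton `k`, where `v` weighs the nonempty gaps. It is `0` when
the lengths of `k` and `gs` differ. -/
noncomputable def gapWeight (b : ℝ≥0∞) (v : List β → ℝ≥0∞) :
    List (Bool × α) → List (List β) → ℝ≥0∞
  | [], [] => 1
  | [_], [g] => if g = [] then 1 else v g
  | x :: y :: k, g :: gs => (if g = [] then wtStep b x y else v g) * gapWeight b v (y :: k) gs
  | _, _ => 0

theorem tsum_list {γ : Type*} (F : List γ → ℝ≥0∞) :
    ∑' l, F l = F [] + ∑' (x) (l), F (x :: l) := by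
  classical
  rw [ENNReal.tsum_eq_add_tsum_ite ([] : List γ)]
  congr 1
  have hi : Function.Injective (fun p : γ × List γ => p.1 :: p.2) := by
    rintro ⟨a, l⟩ ⟨b, m⟩ h
    simpa using h
  rw [← ENNReal.tsum_prod (f := fun x l => F (x :: l)), ← hi.tsum_eq]
  · simp
  · intro l hl
    cases l with
    | nil => simp at hl
    | cons x l => exact ⟨(x, l), rfl⟩

theorem tsum_ite_nil {γ : Type*} (c : ℝ≥0∞) (v : List γ → ℝ≥0∞) :
    ∑' g : List γ, (if g = [] then c else v g) = c + ∑' g, if g = [] then 0 else v g := by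
  rw [tsum_list, tsum_list (fun g => if g = [] then 0 else v g)]
  simp

theorem tsum_gapWeight (b : ℝ≥0∞) (v : List β → ℝ≥0∞) : ∀ k : List (Bool × α),
    ∑' gs, gapWeight b v k gs = gapProd b (∑' g, if g = [] then 0 else v g) k
  | [] => by
    rw [tsum_list]
    simp [gapWeight, gapProd]
  | [x] => by
    rw [tsum_list]
    have : ∀ g, ∑' gs, gapWeight b v [x] (g :: gs) = if g = [] then 1 else v g := by
      intro g
      rw [tsum_list]
      simp [gapWeight]
    simp only [this]
    rw [tsum_ite_nil 1 v]
    simp [gapWeight, gapProd]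
  | x :: y :: k => by
    rw [tsum_list]
    have : ∀ g, ∑' gs, gapWeight b v (x :: y :: k) (g :: gs) =
        (if g = [] then wtStep b x y else v g) *
          gapProd b (∑' g, if g = [] then 0 else v g) (y :: k) := by
      intro g
      rw [← tsum_gapWeight b v (y :: k), ← ENNReal.tsum_mul_left]
      rfl
    simp only [this, ENNReal.tsum_mul_right]
    rw [tsum_ite_nil (wtStep b x y) v]
    simp [gapWeight, gapProd]

theorem gapWeight_ne_zero {b : ℝ≥0∞} {v : List β → ℝ≥0∞} : ∀ {k : List (Bool × α)}
    {gs : List (List β)}, gapWeight b v k gs ≠ 0 →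
      k.length = gs.length ∧ ∀ g ∈ gs, g ≠ [] → v g ≠ 0
  | [], [], _ => by simp
  | [], g :: gs, h => by simp [gapWeight] at h
  | [x], [], h => by simp [gapWeight] at h
  | [x], [g], h => by
    simp only [List.length_singleton, List.mem_singleton, true_and]
    rintro _ rfl hg hv
    simp [gapWeight, hg, hv] at h
  | [x], g :: g' :: gs, h => by simp [gapWeight] at h
  | x :: y :: k, [], h => by simp [gapWeight] at h
  | x :: y :: k, g :: gs, h => by
    rw [gapWeight] at h
    obtain ⟨h1, h2⟩ := mul_ne_zero_iff.1 h
    obtain ⟨h3, h4⟩ := gapWeight_ne_zero h2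
    refine ⟨by simpa using h3, ?_⟩
    intro g' hg' hne
    rw [List.mem_cons] at hg'
    rcases hg' with rfl | hg'
    · rwa [if_neg hne] at h1
    · exact h4 g' hg' hne

/-- The weight of a decomposed word. Nonempty gaps begin with a push and end with a pop, so they do
not interact with the neighbouring letters. -/
theorem wts_flat (s b : ℝ≥0∞) : ∀ (k : List (Bool × α)) (gs : List (List (Bool × α))),
    k.length = gs.length →
    (∀ g ∈ gs, g ≠ [] → ∃ a a' r r', g = (true, a) :: r ∧ g = r' ++ [(false, a')]) →
    wts s b (flat k gs) = s ^ k.length * gapWeight b (wts s b) k gs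
  | [], [], _, _ => by simp [wts, gapWeight]
  | [], g :: gs, h, _ => by simp at h
  | [x], [], h, _ => by simp at h
  | [x], [g], _, h => by
    by_cases hg : g = []
    · simp [hg, gapWeight, wts]
    · obtain ⟨a, a', r, r', h1, -⟩ := h g (by simp) hg
      have h1' := wt_append_of_true b [x] a r
      rw [← h1] at h1'
      simp only [List.singleton_append, wt_singleton, one_mul] at h1'
      simp [wts, gapWeight, hg, h1', pow_succ]
      ring
  | [x], g :: g' :: gs, h, _ => by simp at h
  | x :: y :: k, [], h, _ => by simp at h
  | x :: y :: k, g :: gs, hl, h => by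
    have hl' : (y :: k).length = gs.length := by simpa using hl
    have ih := wts_flat s b (y :: k) gs hl' (fun g' h' => h g' (by simp [h']))
    obtain ⟨t, ht⟩ := head_flat hl'
    rw [gapWeight, flat_cons]
    simp only [wts] at ih ⊢
    by_cases hg : g = []
    · subst hg
      simp only [List.nil_append, if_true, List.length_cons, pow_succ] at ih ⊢
      rw [ht] at ih ⊢
      rw [wt_cons_cons]
      calc _ = (s * wtStep b x y) * (s ^ ((y :: t).length) * wt b (y :: t)) := by
            simp only [List.length_cons, pow_succ]; ring
        _ = _ := by rw [ih]; ring
    · obtain ⟨a, a', r, r', h1, h2⟩ := h g (by simp) hg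
      have e1 : wt b (x :: (g ++ flat (y :: k) gs)) = wt b g * wt b (flat (y :: k) gs) := by
        have := wt_append_of_true b [x] a (r ++ flat (y :: k) gs)
        simp only [List.singleton_append, wt_singleton, one_mul] at this
        have e : g ++ flat (y :: k) gs = (true, a) :: (r ++ flat (y :: k) gs) := by
          rw [h1, List.cons_append]
        rw [e, this, ← e, h2, List.append_assoc, List.singleton_append, wt_append_of_false]
      rw [e1, if_neg hg]
      simp only [List.length_cons, List.length_append, pow_succ, pow_add] at ih ⊢
      calc _ = (s * s ^ g.length * wt b g) * (s ^ (flat (y :: k) gs).length *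
              wt b (flat (y :: k) gs)) := by ring
        _ = _ := by rw [ih]; ring

theorem gapProd_congr {b b' q : ℝ≥0∞} (F : Bool × α → Bool × β) : ∀ k : List (Bool × α),
    (∀ p x y r, k = p ++ x :: y :: r → wtStep b x y = wtStep b' (F x) (F y)) →
    gapProd b q k = gapProd b' q (k.map F)
  | [], _ => by simp [gapProd]
  | [x], _ => by simp [gapProd]
  | x :: y :: k, h => by
    have ih := gapProd_congr (b := b) (b' := b') (q := q) F (y :: k)
      (fun p x' y' r e => h (x :: p) x' y' r (by simp [e]))
    rw [List.map_cons] at ih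
    rw [gapProd, ih, h [] x y k rfl]
    simp [gapProd]

theorem gapProd_mono {b q q' : ℝ≥0∞} (h : q ≤ q') : ∀ k : List (Bool × α),
    gapProd b q k ≤ gapProd b q' k
  | [] => by simp [gapProd]
  | [x] => by simp only [gapProd]; gcongr
  | x :: y :: k => by
    simp only [gapProd]
    have := gapProd_mono (b := b) h (y :: k)
    gcongr

/-! ### Change of labels -/

/-- Replace the labels of a word. With values in `Bool` this colours the word. -/
def relabel (f : α → β) (u : List (Bool × α)) : List (Bool × β) := u.map (Prod.map id f)

@[simp] theorem relabel_length (f : α → β) (u : List (Bool × α)) :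
    (relabel f u).length = u.length := by simp [relabel]

@[simp] theorem relabel_eq_nil (f : α → β) (u : List (Bool × α)) :
    relabel f u = [] ↔ u = [] := by simp [relabel]

theorem relabel_relabel {δ : Type*} (f : α → β) (g : β → δ) (u : List (Bool × α)) :
    relabel g (relabel f u) = relabel (g ∘ f) u := by
  simp [relabel, Function.comp_def]

theorem pops_relabel (f : α → β) (u : List (Bool × α)) :
    pops (relabel f u) = (pops u).map f := by
  simp [relabel, pops, List.filter_map, Function.comp_def]

theorem relabel_flat (f : α → β) (k : List (Bool × α)) (gs) :
    relabel f (flat k gs) = flat (relabel f k) (gs.map (relabel f)) := map_flat _ _ _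

theorem mem_relabel {f : α → β} {u : List (Bool × α)} {t : Bool} {b : β} :
    (t, b) ∈ relabel f u ↔ ∃ a, (t, a) ∈ u ∧ f a = b := by
  cases t <;> simp [relabel]

theorem mem_relabel_of_injective {f : α → β} (hf : Function.Injective f) {u : List (Bool × α)}
    {t : Bool} {a : α} : (t, f a) ∈ relabel f u ↔ (t, a) ∈ u := by
  rw [mem_relabel]
  constructor
  · rintro ⟨a', h, e⟩; rwa [← hf e]
  · exact fun h => ⟨a, h, rfl⟩

theorem Closed.relabel {u : List (Bool × α)} (hu : Closed u) (f : α → β) :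
    Closed (relabel f u) := by
  intro b
  simp only [mem_relabel, hu _]

theorem Closed.of_relabel {f : α → β} (hf : Function.Injective f) {u : List (Bool × α)}
    (hu : Closed (TwoStacks.relabel f u)) : Closed u := by
  intro a
  have := hu (f a)
  rwa [mem_relabel_of_injective hf, mem_relabel_of_injective hf] at this

theorem IsArch.relabel {u : List (Bool × α)} (hu : IsArch u) {f : α → β}
    (hf : Function.Injective f) : IsArch (relabel f u) := by
  refine ⟨hu.nodup.map ?_, hu.closed.relabel f, ?_⟩
  · exact Function.injective_id.prodMap hf
  · intro b h
    obtain ⟨l, hl, e⟩ := List.sublist_map_iff.1 h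
    match l, e with
    | [], e => simp at e
    | [_], e => simp at e
    | _ :: _ :: _ :: _, e => simp at e
    | [(t1, a1), (t2, a2)], e =>
      simp only [List.map_cons, List.map_nil, List.cons.injEq, Prod.map, id_eq, Prod.mk.injEq,
        and_true] at e
      obtain ⟨⟨rfl, h1⟩, rfl, h2⟩ := e
      obtain rfl := hf (h1.symm.trans h2)
      exact hu.order _ hl

theorem NonCrossing.relabel {u : List (Bool × α)} {c : α → Bool} (hc : NonCrossing c u)
    {f : α → β} (hf : Function.Injective f) {c' : β → Bool} (hcc : ∀ a, c' (f a) = c a) :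
    NonCrossing c' (relabel f u) := by
  intro a b hab h
  obtain ⟨l, hl, e⟩ := List.sublist_map_iff.1 h
  match l, e with
  | [], e => simp at e
  | [_], e => simp at e
  | [_, _], e => simp at e
  | [_, _, _], e => simp at e
  | _ :: _ :: _ :: _ :: _ :: _, e => simp at e
  | [(t1, a1), (t2, a2), (t3, a3), (t4, a4)], e =>
    simp only [List.map_cons, List.map_nil, List.cons.injEq, Prod.map, id_eq, Prod.mk.injEq,
      and_true] at e
    obtain ⟨⟨rfl, h1⟩, ⟨rfl, h2⟩, ⟨rfl, h3⟩, rfl, h4⟩ := e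
    obtain rfl := hf (h1.symm.trans h3)
    obtain rfl := hf (h2.symm.trans h4)
    refine hc _ _ ?_ hl
    rw [← hcc, ← hcc, ← h1, ← h2, hab]

theorem Primitive.relabel {k : List (Bool × α)} (hk : Primitive k) {f : α → β}
    (hf : Function.Injective f) : Primitive (relabel f k) := by
  refine ⟨by simpa using hk.1, ?_⟩
  intro x v y e hx hv
  obtain ⟨l1, y', rfl, h1, rfl⟩ := List.map_eq_append_iff.1 e
  obtain ⟨x', v', rfl, rfl, rfl⟩ := List.map_eq_append_iff.1 h1
  have := hk.2 x' v' y' rfl (by rintro rfl; simp at hx) (Closed.of_relabel hf hv)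
  simp [this]

theorem wtStep_relabel (b : ℝ≥0∞) {f : α → β} (hf : Function.Injective f) (x y : Bool × α) :
    wtStep b (Prod.map id f x) (Prod.map id f y) = wtStep b x y := by
  by_cases h : x.2 = y.2
  · simp [wtStep, h]
  · have h' : f x.2 ≠ f y.2 := fun e => h (hf e)
    simp [wtStep, h, h']

theorem wt_relabel (b : ℝ≥0∞) {f : α → β} (hf : Function.Injective f) :
    ∀ u : List (Bool × α), wt b (relabel f u) = wt b u
  | [] => by simp [relabel]
  | [x] => by simp [relabel]
  | x :: y :: r => by
    have := wt_relabel b hf (y :: r)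
    simp only [relabel, List.map_cons] at this ⊢
    rw [wt_cons_cons, this, wtStep_relabel b hf, wt_cons_cons]

theorem wts_relabel (s b : ℝ≥0∞) {f : α → β} (hf : Function.Injective f) (u : List (Bool × α)) :
    wts s b (relabel f u) = wts s b u := by
  simp [wts, wt_relabel b hf]

/-- A numbering of the elements of `l` in their order, extended injectively to all numbers. -/
def numbering (l : List ℕ) (a : ℕ) : ℕ := if a ∈ l then l.idxOf a else l.length + a

theorem numbering_injective (l : List ℕ) : Function.Injective (numbering l) := by
  intro a b h
  unfold numbering at h
  split_ifs at h with h1 h2 h2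
  · exact (List.idxOf_inj h1).1 h
  · have := List.idxOf_lt_length_iff.2 h1; omega
  · have := List.idxOf_lt_length_iff.2 h2; omega
  · omega

theorem map_numbering {l : List ℕ} (hl : l.Nodup) : l.map (numbering l) = List.range l.length := by
  apply List.ext_getElem (by simp)
  intro i h1 h2
  simp [numbering, hl.idxOf_getElem]

/-- The labels are popped in the order `0, 1, 2, …`. -/
def Standard (u : List (Bool × ℕ)) : Prop := pops u = List.range (pops u).length

/-- The relabelling that makes an arch system standard. -/
def standardize (u : List (Bool × ℕ)) : List (Bool × ℕ) := relabel (numbering (pops u)) u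

theorem IsArch.pops_nodup {u : List (Bool × α)} (hu : IsArch u) : (pops u).Nodup := by
  refine (hu.nodup.filter _).map_on ?_
  rintro ⟨t, a⟩ h ⟨t', a'⟩ h' e
  simp at h h' e
  simp [h, h', e]

theorem IsArch.standardize {u : List (Bool × ℕ)} (hu : IsArch u) :
    Standard (standardize u) := by
  unfold Standard TwoStacks.standardize
  rw [pops_relabel, map_numbering hu.pops_nodup, List.length_range]

/-- Standard words that agree up to relabelling are equal. -/
theorem eq_of_relabel_eq {u u' : List (Bool × ℕ)} (hs : Standard u) (hs' : Standard u')
    (hu : Closed u) {f f' : ℕ → β} (hf' : Function.Injective f')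
    (e : relabel f u = relabel f' u') : u = u' := by
  have h1 : (pops u).map f = (pops u').map f' := by rw [← pops_relabel, e, pops_relabel]
  have hl : (pops u).length = (pops u').length := by simpa using congrArg List.length h1
  rw [hs, hs', hl] at h1
  have h2 : ∀ a ∈ List.range (pops u').length, f a = f' a := List.map_inj_left.1 h1
  have h3 : relabel f u = relabel f' u := by
    refine List.map_congr_left ?_
    rintro ⟨t, a⟩ hx
    have : a ∈ pops u := mem_pops.2 ((hu.mem_iff t false a).1 hx)
    rw [hs, hl] at this
    simp [h2 a this]
  rw [h3] at e
  exact List.map_injective_iff.2 (Function.injective_id.prodMap hf') e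

/-! ### Arch systems and sortable permutations -/

/-- The arches can be distributed over the two stacks without crossings on one stack. -/
def Colourable (u : List (Bool × α)) : Prop := ∃ c, NonCrossing c u

theorem Colourable.relabel {u : List (Bool × α)} (hu : Colourable u) {f : α → β}
    (hf : Function.Injective f) : Colourable (relabel f u) := by
  obtain ⟨c, hc⟩ := hu
  refine ⟨Function.extend f c (fun _ => false), hc.relabel hf ?_⟩
  intro a
  rw [hf.extend_apply]

open Classical in
/-- The weight of a nonempty standard colourable arch system that pops as early as possible. With
`b = 1` the factor `wt` is only the indicator of the last condition. -/
noncomputable def archWeight (s : ℝ≥0∞) (u : List (Bool × ℕ)) : ℝ≥0∞ :=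
  if u ≠ [] ∧ IsArch u ∧ Colourable u ∧ Standard u then wts s 1 u else 0

/-- The generating function of the nonempty standard colourable arch systems that pop as early as
possible, with `s` for each letter. -/
noncomputable def archSum (s : ℝ≥0∞) : ℝ≥0∞ := ∑' u, archWeight s u

theorem archWeight_ne_zero {s : ℝ≥0∞} {u : List (Bool × ℕ)} (h : archWeight s u ≠ 0) :
    (u ≠ [] ∧ IsArch u ∧ Colourable u ∧ Standard u) ∧ wts s 1 u ≠ 0 := by
  unfold archWeight at h
  split_ifs at h with h1
  · exact ⟨h1, h⟩
  · exact absurd rfl h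

theorem length_eq_pushes_add_pops (u : List (Bool × α)) :
    u.length = (pushes u).length + (pops u).length := by
  induction u with
  | nil => simp
  | cons z u ih => obtain ⟨_ | _, a⟩ := z <;> simp [ih] <;> omega

/-- The pushes of a standard colourable arch system form a sortable word. -/
theorem one_add_archSum_le (s : ℝ≥0∞) : 1 + archSum s ≤ genFun (s ^ 2) := by
  classical
  rw [genFun_eq_one_add]
  gcongr
  refine tsum_le_tsum_of_injOn pushes ?_ ?_
  · intro u u' hu hu' e
    obtain ⟨⟨-, h1, -, h2⟩, h3⟩ := archWeight_ne_zero hu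
    obtain ⟨⟨-, h1', ⟨c', hc'⟩, h2'⟩, h3'⟩ := archWeight_ne_zero hu'
    have hl : ∀ u : List (Bool × ℕ), IsArch u → Colourable u →
        (pops u).length = (pushes u).length := by
      rintro u hu ⟨c, hc⟩
      simpa using (steps_perm (hu.steps hc)).length_eq.symm
    refine eq_of_pushes_eq_of_pops_eq (wt_ne_zero (b := 1) ?_) (wt_ne_zero (b := 1) ?_) h1.order
      h1'.order e ?_
    · exact (mul_ne_zero_iff.1 h3).2
    · exact (mul_ne_zero_iff.1 h3').2
    · rw [h2, h2', hl u h1 (archWeight_ne_zero hu).1.2.2.1, e, hl u' h1' ⟨c', hc'⟩]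
  · intro u hu
    obtain ⟨⟨h0, h1, ⟨c, hc⟩, h2⟩, h3⟩ := archWeight_ne_zero hu
    have hst := h1.steps hc
    have hl : (pushes u).length = (pops u).length := by simpa using (steps_perm hst).length_eq
    have hso : Sorts (pushes u) := by
      unfold Sorts
      rw [hl, ← h2]
      exact hst
    have hne : pushes u ≠ [] := by
      intro h
      rw [h] at hl
      have := length_eq_pushes_add_pops u
      rw [← hl, h] at this
      exact h0 (List.length_eq_zero_iff.1 (by simpa using this))
    rw [if_neg hne, if_pos hso, archWeight, if_pos ⟨h0, h1, ⟨c, hc⟩, h2⟩, wts,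
      length_eq_pushes_add_pops u, ← hl, ← pow_mul, two_mul]
    exact mul_le_of_le_one_right' (wt_one_le_one u)

/-! ### Insertion of arch systems -/

theorem IsArch.eq_cons_append {u : List (Bool × α)} (hu : IsArch u) (h : u ≠ []) :
    ∃ a a' r r', u = (true, a) :: r ∧ u = r' ++ [(false, a')] := by
  obtain ⟨⟨t, a⟩, r, rfl⟩ := List.exists_cons_of_ne_nil h
  obtain ⟨r', ⟨t', a'⟩, e⟩ : ∃ r' x, (t, a) :: r = r' ++ [x] := by
    rcases List.eq_nil_or_concat ((t, a) :: r) with h | ⟨r', x, h⟩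
    · simp at h
    · exact ⟨r', x, by rw [h, List.concat_eq_append]⟩
  have ht : t = true := by
    cases t
    · exfalso
      have : (true, a) ∈ (false, a) :: r := (hu.closed a).2 (by simp)
      rw [List.mem_cons] at this
      rcases this with h | h
      · simp at h
      · exact hu.order a ((List.singleton_sublist.2 h).cons_cons _)
    · rfl
  have ht' : t' = false := by
    cases t'
    · rfl
    · exfalso
      have : (false, a') ∈ (t, a) :: r := (hu.closed a').1 (by rw [e]; simp)
      rw [e, List.mem_append] at this
      rcases this with h | h
      · refine hu.order a' ?_
        rw [e]
        exact (List.singleton_sublist.2 h).append (List.Sublist.refl _)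
      · simp at h
  subst ht ht'
  exact ⟨a, a', r, r', rfl, e⟩

theorem mem_of_sublist_between {x v y : List γ} {p q r : γ} (h : [p, q, r].Sublist (x ++ v ++ y))
    (hp : p ∉ x) (hr : r ∉ y) : q ∈ v := by
  rw [List.append_assoc, List.sublist_append_iff] at h
  obtain ⟨l1, l2, e, h1, h2⟩ := h
  have hl1 : l1 = [] := by
    cases l1 with
    | nil => rfl
    | cons z l =>
      simp only [List.cons_append, List.cons.injEq] at e
      exact absurd (h1.subset (by simp [e.1])) hp
  rw [hl1, List.nil_append] at e
  rw [← e, List.sublist_append_iff] at h2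
  obtain ⟨l3, l4, e', h3, h4⟩ := h2
  have hl4 : l4 = [] := by
    rcases List.eq_nil_or_concat l4 with h | ⟨l, z, rfl⟩
    · exact h
    · rw [List.concat_eq_append, ← List.append_assoc] at e'
      have e'' : [p, q] ++ [r] = (l3 ++ l) ++ [z] := e'
      have := (List.append_inj' e'' rfl).2
      simp only [List.cons.injEq, and_true] at this
      exact absurd (h4.subset (by simp [this])) hr
  rw [hl4, List.append_nil] at e'
  exact h3.subset (by rw [← e']; simp)

theorem filter_insert {p : γ → Bool} {x v y : List γ} (hv : ∀ z ∈ v, p z = true)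
    (hxy : ∀ z ∈ x ++ y, p z = false) :
    (x ++ v ++ y).filter p = v ∧ (x ++ v ++ y).filter (fun z => !p z) = x ++ y := by
  have hx : ∀ z ∈ x, p z = false := fun z h => hxy z (List.mem_append_left _ h)
  have hy : ∀ z ∈ y, p z = false := fun z h => hxy z (List.mem_append_right _ h)
  constructor
  · rw [List.filter_append, List.filter_append, List.filter_eq_nil_iff.2, List.filter_eq_self.2 hv,
      List.filter_eq_nil_iff.2]
    · simp
    · exact fun z h => by simp [hy z h]
    · exact fun z h => by simp [hx z h]
  · rw [List.filter_append, List.filter_append, List.filter_eq_self.2, List.filter_eq_nil_iff.2,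
      List.filter_eq_self.2]
    · simp
    · exact fun z h => by simp [hy z h]
    · exact fun z h => by simp [hv z h]
    · exact fun z h => by simp [hx z h]

/-- An arch system with new labels can be inserted as a factor. -/
theorem IsArch.insert {x v y : List (Bool × α)} (hu : IsArch (x ++ y)) (hv : IsArch v)
    (hd : ∀ s t a, (s, a) ∈ x ++ y → (t, a) ∉ v) : IsArch (x ++ v ++ y) := by
  refine ⟨?_, ?_, ?_⟩
  · have : (v ++ (x ++ y)).Nodup := by
      rw [List.nodup_append]
      refine ⟨hv.nodup, hu.nodup, ?_⟩
      rintro ⟨s, a⟩ h1 _ h2 rfl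
      exact hd s s a h2 h1
    refine (List.Perm.nodup_iff ?_).1 this
    rw [← List.append_assoc]
    exact List.perm_append_comm.append_right y
  · intro a
    have h1 := hu.closed a
    have h2 := hv.closed a
    simp only [List.mem_append] at h1 ⊢
    tauto
  · intro a h
    classical
    let p : Bool × α → Bool := fun z => decide (∃ t, (t, z.2) ∈ v)
    have hpv : ∀ z ∈ v, p z = true := fun z hz => by
      simp only [p, decide_eq_true_eq]; exact ⟨z.1, hz⟩
    have hpx : ∀ z ∈ x ++ y, p z = false := by
      intro z hz
      simp only [p, decide_eq_false_iff_not, not_exists]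
      exact fun t => hd z.1 t z.2 hz
    have h1 := h.filter p
    have h2 := h.filter (fun z => !p z)
    rw [(filter_insert hpv hpx).1] at h1
    rw [(filter_insert hpv hpx).2] at h2
    have hpp : p (false, a) = p (true, a) := rfl
    by_cases hpa : p (true, a) = true
    · refine hv.order a ?_
      simpa [List.filter_cons, hpp, hpa] using h1
    · refine hu.order a ?_
      simpa [List.filter_cons, hpp, hpa] using h2

/-- Colourings of an arch system and of an inserted factor combine, since an arch of the one does not
cross an arch of the other. -/
theorem Colourable.insert {x v y : List (Bool × α)} (hv : IsArch v)
    (hd : ∀ s t a, (s, a) ∈ x ++ y → (t, a) ∉ v) (hcu : Colourable (x ++ y))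
    (hcv : Colourable v) : Colourable (x ++ v ++ y) := by
  classical
  obtain ⟨c, hc⟩ := hcu
  obtain ⟨c', hc'⟩ := hcv
  have hd' : ∀ s t a, (t, a) ∈ v → (s, a) ∉ x ∧ (s, a) ∉ y := by
    intro s t a h
    constructor
    · exact fun h' => hd s t a (List.mem_append_left _ h') h
    · exact fun h' => hd s t a (List.mem_append_right _ h') h
  refine ⟨fun a => if (true, a) ∈ v then c' a else c a, ?_⟩
  intro a b hab h
  let p : Bool × α → Bool := fun z => decide ((true, z.2) ∈ v)
  have hpv : ∀ z ∈ v, p z = true := fun z hz => by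
    simp only [p, decide_eq_true_eq]; exact (hv.closed.mem_iff z.1 true z.2).1 hz
  have hpx : ∀ z ∈ x ++ y, p z = false := by
    intro z hz
    simp only [p, decide_eq_false_iff_not]
    exact hd z.1 true z.2 hz
  by_cases ha : (true, a) ∈ v
  · have ha' := (hv.closed a).1 ha
    have hb : (true, b) ∈ v := by
      refine mem_of_sublist_between (p := (true, a)) (r := (false, a)) (x := x) (y := y) ?_
        (hd' _ _ _ ha).1 (hd' _ _ _ ha).2
      exact (List.sublist_append_left [(true, a), (true, b), (false, a)] [(false, b)]).trans h
    have h1 := h.filter p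
    rw [(filter_insert hpv hpx).1] at h1
    refine hc' a b (by simpa [ha, hb] using hab) ?_
    simpa [List.filter_cons, p, ha, hb] using h1
  · by_cases hb : (true, b) ∈ v
    · have hb' := (hv.closed b).1 hb
      have hFa : (false, a) ∈ v := by
        refine mem_of_sublist_between (p := (true, b)) (r := (false, b)) (x := x) (y := y) ?_
          (hd' _ _ _ hb).1 (hd' _ _ _ hb).2
        exact (List.sublist_cons_self _ _).trans h
      exact ha ((hv.closed a).2 hFa)
    · have h1 := h.filter (fun z => !p z)
      rw [(filter_insert hpv hpx).2] at h1
      refine hc a b (by simpa [ha, hb] using hab) ?_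
      simpa [List.filter_cons, p, ha, hb] using h1

/-! ### Substitution into primitive arch systems: uncoloured count -/

/-- Give the gaps disjoint sets of labels, by pairing the labels of the gaps with `i`, `i + 1`, …. -/
def tagGaps : ℕ → List (List (Bool × ℕ)) → List (List (Bool × ℕ))
  | i, g :: gs => relabel (Nat.pair i) g :: tagGaps (i + 1) gs
  | _, [] => []

theorem pair_injective (i : ℕ) : Function.Injective (Nat.pair i) := by
  intro a b h
  exact (Nat.pair_eq_pair.1 h).2

@[simp] theorem tagGaps_length : ∀ (i : ℕ) (gs), (tagGaps i gs).length = gs.length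
  | _, [] => rfl
  | i, g :: gs => by simp [tagGaps, tagGaps_length (i + 1) gs]

theorem mem_tagGaps : ∀ (i : ℕ) (gs) {g}, g ∈ tagGaps i gs →
    ∃ j ≥ i, ∃ g' ∈ gs, g = relabel (Nat.pair j) g'
  | i, [], g, h => by simp [tagGaps] at h
  | i, g0 :: gs, g, h => by
    rw [tagGaps, List.mem_cons] at h
    rcases h with rfl | h
    · exact ⟨i, le_rfl, g0, by simp, rfl⟩
    · obtain ⟨j, hj, g', hg', e⟩ := mem_tagGaps (i + 1) gs h
      exact ⟨j, by omega, g', by simp [hg'], e⟩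

theorem fst_unpair_of_mem_relabel {i : ℕ} {u : List (Bool × ℕ)} {z : Bool × ℕ}
    (h : z ∈ relabel (Nat.pair i) u) : z.2.unpair.1 = i := by
  obtain ⟨t, a⟩ := z
  obtain ⟨a', -, rfl⟩ := mem_relabel.1 h
  simp

theorem arch_flat_tagGaps : ∀ (i : ℕ) (z k : List (Bool × ℕ)) (gs : List (List (Bool × ℕ))),
    0 < i → k.length = gs.length → (∀ x ∈ z ++ k, x.2.unpair.1 = 0) →
    (∀ g ∈ gs, IsArch g ∧ Colourable g) → IsArch (z ++ k) → Colourable (z ++ k) →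
    IsArch (z ++ flat k (tagGaps i gs)) ∧ Colourable (z ++ flat k (tagGaps i gs))
  | i, z, [], gs, _, _, _, _, h1, h2 => by simpa using ⟨by simpa using h1, by simpa using h2⟩
  | i, z, x :: k, [], _, h, _, _, _, _ => by simp at h
  | i, z, x :: k, g :: gs, hi, hl, h0, hg, h1, h2 => by
    have e : ∀ r, z ++ x :: r = (z ++ [x]) ++ r := by simp
    obtain ⟨h3, h4⟩ := arch_flat_tagGaps (i + 1) (z ++ [x]) k gs (by omega) (by simpa using hl)
      (by rw [← e]; exact h0) (fun g' h' => hg g' (by simp [h'])) (by rw [← e]; exact h1)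
      (by rw [← e]; exact h2)
    have hgi := hg g (by simp)
    have hd : ∀ s t a, (s, a) ∈ z ++ [x] ++ flat k (tagGaps (i + 1) gs) →
        (t, a) ∉ relabel (Nat.pair i) g := by
      intro s t a hs ht
      have hti : a.unpair.1 = i := fst_unpair_of_mem_relabel ht
      have hz : ∀ y, y ∈ z ++ x :: k → y = (s, a) → False := by
        rintro y hy rfl
        have := h0 _ hy
        simp only at this
        omega
      rw [List.mem_append] at hs
      rcases hs with hs | hs
      · refine hz (s, a) ?_ rfl
        rw [e]; exact List.mem_append_left _ hs
      · rcases mem_flat _ _ hs with hs | ⟨g', hg', hs⟩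
        · exact hz (s, a) (by simp [hs]) rfl
        · obtain ⟨j, hj, g'', -, rfl⟩ := mem_tagGaps _ _ hg'
          have : a.unpair.1 = j := fst_unpair_of_mem_relabel hs
          omega
    have hr : IsArch (relabel (Nat.pair i) g) := hgi.1.relabel (pair_injective i)
    rw [tagGaps, flat_cons, e, ← List.append_assoc]
    exact ⟨h3.insert hr hd, Colourable.insert hr hd h4 (hgi.2.relabel (pair_injective i))⟩

theorem gapWeight_tagGaps {b s : ℝ≥0∞} {v : List (Bool × ℕ) → ℝ≥0∞} {f : ℕ → ℕ}
    (hf : Function.Injective f) : ∀ (i : ℕ) (k : List (Bool × ℕ))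
    (gs : List (List (Bool × ℕ))), (∀ g ∈ gs, g ≠ [] → v g = wts s b g) →
      gapWeight b (wts s b) (relabel f k) (tagGaps i gs) = gapWeight b v k gs
  | i, [], [], _ => rfl
  | i, [], g :: gs, _ => by simp [gapWeight, tagGaps, relabel]
  | i, [x], [], _ => by simp [gapWeight, tagGaps, relabel]
  | i, [x], [g], h => by
    simp only [relabel, tagGaps, List.map_cons, List.map_nil, gapWeight]
    have e := relabel_eq_nil (Nat.pair i) g
    have e' := wts_relabel s b (pair_injective i) g
    unfold relabel at e e'
    simp only [e, e']
    split_ifs with hg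
    · rfl
    · rw [h g (by simp) hg]
  | i, [x], g :: g' :: gs, _ => by simp [gapWeight, tagGaps, relabel]
  | i, x :: y :: k, [], _ => by simp [gapWeight, tagGaps, relabel]
  | i, x :: y :: k, g :: gs, h => by
    have ih := gapWeight_tagGaps (b := b) (s := s) (v := v) hf (i + 1) (y :: k) gs
      (fun g' h' => h g' (by simp [h']))
    simp only [relabel, tagGaps, List.map_cons, gapWeight] at ih ⊢
    rw [ih]
    congr 1
    have e := relabel_eq_nil (Nat.pair i) g
    have e' := wts_relabel s b (pair_injective i) g
    unfold relabel at e e'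
    simp only [e, e', wtStep_relabel b hf]
    split_ifs with hg
    · rfl
    · rw [h g (by simp) hg]

/-- Standard colourable primitive arch systems. -/
def PrimArch (k : List (Bool × ℕ)) : Prop :=
  Primitive k ∧ IsArch k ∧ Colourable k ∧ Standard k

open Classical in
/-- The total weight of all decomposed words whose skeleton is a standard colourable primitive arch
system, when the nonempty gap words have total weight `q`. -/
noncomputable def primSum (s b q : ℝ≥0∞) : ℝ≥0∞ :=
  ∑' k : List (Bool × ℕ), if PrimArch k then s ^ k.length * gapProd b q k else 0

theorem tagGaps_relabel_injective {f f' : ℕ → ℕ} (hf : Function.Injective f)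
    (hf' : Function.Injective f') : ∀ (i : ℕ) (gs gs' : List (List (Bool × ℕ))),
    (∀ g ∈ gs, IsArch g ∧ Standard g) → (∀ g ∈ gs', IsArch g ∧ Standard g) →
    (tagGaps i gs).map (relabel f) = (tagGaps i gs').map (relabel f') → gs = gs'
  | i, [], [], _, _, _ => rfl
  | i, [], g :: gs, _, _, e => by simp [tagGaps] at e
  | i, g :: gs, [], _, _, e => by simp [tagGaps] at e
  | i, g :: gs, g' :: gs', h, h', e => by
    simp only [tagGaps, List.map_cons, List.cons.injEq, relabel_relabel] at e
    congr 1
    · exact eq_of_relabel_eq (h g (by simp)).2 (h' g' (by simp)).2 (h g (by simp)).1.closed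
        (hf'.comp (pair_injective i)) e.1
    · exact tagGaps_relabel_injective hf hf' (i + 1) gs gs' (fun g h1 => h g (by simp [h1]))
        (fun g h1 => h' g (by simp [h1])) e.2

theorem IsArch.nil : IsArch ([] : List (Bool × α)) :=
  ⟨List.nodup_nil, Closed.nil, by simp⟩

theorem Colourable.nil : Colourable ([] : List (Bool × α)) :=
  ⟨fun _ => true, fun a b _ h => by simp at h⟩

theorem Standard.nil : Standard [] := by simp [Standard]

/-- Arch systems in the gaps of a primitive skeleton compose to a new arch system, and the composite
determines the skeleton and the gaps. -/
theorem primSum_le (s : ℝ≥0∞) : primSum s 1 (archSum s) ≤ archSum s := by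
  classical
  have h1 : primSum s 1 (archSum s) = ∑' p : List (Bool × ℕ) × List (List (Bool × ℕ)),
      (if PrimArch p.1 then s ^ p.1.length * gapWeight 1 (archWeight s) p.1 p.2 else 0) := by
    rw [ENNReal.tsum_prod (f := fun k gs =>
      if PrimArch k then s ^ k.length * gapWeight 1 (archWeight s) k gs else 0)]
    unfold primSum
    refine tsum_congr fun k => ?_
    split_ifs with hk
    · rw [ENNReal.tsum_mul_left, tsum_gapWeight]
      congr 2
      refine tsum_congr fun u => ?_
      by_cases hu : u = []
      · simp [hu, archWeight]
      · simp [hu]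
    · simp
  rw [h1]
  have hsupp : ∀ p : List (Bool × ℕ) × List (List (Bool × ℕ)),
      (if PrimArch p.1 then s ^ p.1.length * gapWeight 1 (archWeight s) p.1 p.2 else 0) ≠ 0 →
      PrimArch p.1 ∧ p.1.length = p.2.length ∧
      (∀ g ∈ p.2, IsArch g ∧ Colourable g ∧ Standard g) ∧
      (∀ g ∈ p.2, g ≠ [] → archWeight s g = wts s 1 g) := by
    rintro ⟨k, gs⟩ h
    have hk : PrimArch k := by
      by_contra hk; simp [hk] at h
    rw [if_pos hk] at h
    obtain ⟨h2, h3⟩ := gapWeight_ne_zero (mul_ne_zero_iff.1 h).2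
    refine ⟨hk, h2, ?_, ?_⟩
    · intro g hg
      by_cases hg0 : g = []
      · rw [hg0]; exact ⟨IsArch.nil, Colourable.nil, Standard.nil⟩
      · exact (archWeight_ne_zero (h3 g hg hg0)).1.2
    · intro g hg hg0
      rw [archWeight, if_pos (archWeight_ne_zero (h3 g hg hg0)).1]
  let U : List (Bool × ℕ) × List (List (Bool × ℕ)) → List (Bool × ℕ) :=
    fun p => flat (relabel (Nat.pair 0) p.1) (tagGaps 1 p.2)
  have hU : ∀ p : List (Bool × ℕ) × List (List (Bool × ℕ)), PrimArch p.1 →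
      p.1.length = p.2.length → (∀ g ∈ p.2, IsArch g ∧ Colourable g ∧ Standard g) →
      IsArch (U p) ∧ Colourable (U p) := by
    rintro ⟨k, gs⟩ hk hl hg
    have := arch_flat_tagGaps 1 [] (relabel (Nat.pair 0) k) gs one_pos (by simpa using hl)
      (by intro x hx; exact fst_unpair_of_mem_relabel (by simpa using hx))
      (fun g h => ⟨(hg g h).1, (hg g h).2.1⟩) (hk.2.1.relabel (pair_injective 0))
      (hk.2.2.1.relabel (pair_injective 0))
    simpa using this
  have hgc : ∀ gs : List (List (Bool × ℕ)), (∀ g ∈ gs, IsArch g ∧ Colourable g ∧ Standard g) →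
      ∀ f : ℕ → ℕ, ∀ g ∈ (tagGaps 1 gs).map (relabel f), Closed g := by
    intro gs hgs f g hg
    obtain ⟨g1, hg1, rfl⟩ := List.mem_map.1 hg
    obtain ⟨j, -, g2, hg2, rfl⟩ := mem_tagGaps _ _ hg1
    exact ((hgs g2 hg2).1.closed.relabel _).relabel _
  refine tsum_le_tsum_of_injOn (fun p => standardize (U p)) ?_ ?_
  · rintro ⟨k, gs⟩ ⟨k', gs'⟩ h h' e
    obtain ⟨hk, hl, hg, -⟩ := hsupp _ h
    obtain ⟨hk', hl', hg', -⟩ := hsupp _ h'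
    have hUk := (hU _ hk hl hg).1
    set f := numbering (pops (U (k, gs))) with hf
    set f' := numbering (pops (U (k', gs'))) with hf'
    have hfi : Function.Injective f := numbering_injective _
    have hfi' : Function.Injective f' := numbering_injective _
    have e' : relabel f (U (k, gs)) = relabel f' (U (k', gs')) := e
    have hn : (relabel f (U (k, gs))).Nodup := (hUk.relabel hfi).nodup
    simp only [U, relabel_flat] at e' hn
    obtain ⟨e1, e2⟩ := flat_primitive_unique (by simpa using hl) (by simpa using hl') hn
      ((hk.1.relabel (pair_injective 0)).relabel hfi)
      ((hk'.1.relabel (pair_injective 0)).relabel hfi') (hgc gs hg f) (hgc gs' hg' f') e'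
    rw [relabel_relabel, relabel_relabel] at e1
    have e3 := eq_of_relabel_eq hk.2.2.2 hk'.2.2.2 hk.2.1.closed
      (hfi'.comp (pair_injective 0)) e1
    have e4 := tagGaps_relabel_injective hfi hfi' 1 gs gs'
      (fun g h => ⟨(hg g h).1, (hg g h).2.2⟩) (fun g h => ⟨(hg' g h).1, (hg' g h).2.2⟩) e2
    exact Prod.ext e3 e4
  · rintro ⟨k, gs⟩ h
    obtain ⟨hk, hl, hg, hw⟩ := hsupp _ h
    obtain ⟨hU1, hU2⟩ := hU _ hk hl hg
    have hne : standardize (U (k, gs)) ≠ [] := by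
      obtain ⟨z, k', rfl⟩ := List.exists_cons_of_ne_nil hk.1.1
      unfold standardize
      rw [ne_eq, relabel_eq_nil]
      obtain ⟨r, hr⟩ := head_flat (x := Prod.map id (Nat.pair 0) z)
        (k := relabel (Nat.pair 0) k') (gs := tagGaps 1 gs) (by simpa using hl)
      have : U (z :: k', gs) = _ := hr
      rw [this]; simp
    have hi := numbering_injective (pops (U (k, gs)))
    rw [if_pos hk, archWeight, if_pos ⟨hne, hU1.relabel hi, hU2.relabel hi, hU1.standardize⟩]
    unfold standardize
    rw [wts_relabel s 1 hi]
    simp only [U]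
    rw [wts_flat, gapWeight_tagGaps (pair_injective 0) 1 k gs hw, relabel_length]
    · simpa using hl
    · intro g hg' hne
      obtain ⟨j, -, g2, hg2, rfl⟩ := mem_tagGaps _ _ hg'
      exact ((hg g2 hg2).1.relabel (pair_injective j)).eq_cons_append hne

/-! ### Substitution into primitive arch systems: coloured count -/

/-- The coloured word (a list of pushes and pops on two stacks) comes from an arch system coloured
without crossings. -/
def IsValid (w : List (Bool × Bool)) : Prop :=
  ∃ (u : List (Bool × ℕ)) (c : ℕ → Bool), IsArch u ∧ NonCrossing c u ∧ relabel c u = w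

open Classical in
/-- The weight of a nonempty valid coloured word of length at most `N`. -/
noncomputable def colWeight (s b : ℝ≥0∞) (N : ℕ) (w : List (Bool × Bool)) : ℝ≥0∞ :=
  if w ≠ [] ∧ w.length ≤ N ∧ IsValid w then wts s b w else 0

/-- The total weight of the nonempty valid coloured words of length at most `N`. -/
noncomputable def colSum (s b : ℝ≥0∞) (N : ℕ) : ℝ≥0∞ := ∑' w, colWeight s b N w

theorem NonCrossing.sublist {c : α → Bool} {u v : List (Bool × α)} (hu : NonCrossing c u)
    (h : v.Sublist u) : NonCrossing c v := fun a b hab h' => hu a b hab (h'.trans h)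

theorem IsArch.of_sublist {u v : List (Bool × α)} (hu : IsArch u) (h : v.Sublist u)
    (hv : Closed v) : IsArch v :=
  ⟨h.nodup hu.nodup, hv, fun a h' => hu.order a (h'.trans h)⟩

theorem sublist_flat_of_gap {k : List γ} {gs : List (List γ)} (hl : k.length = gs.length)
    {g : List γ} (hg : g ∈ gs) : g.Sublist (flat k gs) := by
  obtain ⟨x, y, -, e⟩ := flat_eq_of_gap k gs hl g hg
  rw [e]
  exact (List.sublist_append_right x g).trans (List.sublist_append_left _ y)

theorem closed_skeleton {k : List (Bool × α)} {gs : List (List (Bool × α))}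
    (hl : k.length = gs.length) (hu : IsArch (flat k gs)) (hg : ∀ g ∈ gs, Closed g) :
    Closed k := by
  have key : ∀ t t' a, (t, a) ∈ k → (t', a) ∈ k := by
    intro t t' a h
    have h1 := (hu.closed.mem_iff t t' a).1 ((sublist_flat k gs hl).subset h)
    rcases mem_flat _ _ h1 with h1 | ⟨g, hg', h1⟩
    · exact h1
    · exact absurd h (flat_nodup_disjoint k gs hl hu.nodup g hg' _ (((hg g hg').mem_iff t' t a).1 h1))
  exact fun a => ⟨key _ _ a, key _ _ a⟩

theorem length_flat_of_gap {k : List γ} {gs : List (List γ)} (hl : k.length = gs.length)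
    {g : List γ} (hg : g ∈ gs) : g.length < (flat k gs).length := by
  obtain ⟨x, y, hx, e⟩ := flat_eq_of_gap k gs hl g hg
  rw [e]
  have := List.length_pos_iff.2 hx
  simp only [List.length_append]
  omega

/-- Coloured primitive arch systems. -/
def ColPrim (K : List (Bool × Bool)) : Prop :=
  ∃ (k : List (Bool × ℕ)) (c : ℕ → Bool), PrimArch k ∧ NonCrossing c k ∧ relabel c k = K

/-- A valid coloured word decomposes into a coloured primitive skeleton and valid gaps. -/
theorem exists_colPrim_flat {w : List (Bool × Bool)} (hw : IsValid w) (h0 : w ≠ []) :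
    ∃ K gs, ColPrim K ∧ K.length = gs.length ∧ flat K gs = w ∧ ∀ g ∈ gs, IsValid g := by
  obtain ⟨u, c, hu, hc, rfl⟩ := hw
  obtain ⟨k, gs, hl, hk, hg, rfl⟩ := exists_primitive_flat u.length u le_rfl (by simpa using h0)
  refine ⟨relabel c k, gs.map (relabel c), ?_, by simpa using hl, (relabel_flat c k gs).symm, ?_⟩
  · have hka : IsArch k := hu.of_sublist (sublist_flat k gs hl) (closed_skeleton hl hu hg)
    have hkc : NonCrossing c k := hc.sublist (sublist_flat k gs hl)
    have hf := numbering_injective (pops k)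
    have he : ∀ a, Function.extend (numbering (pops k)) c (fun _ => false)
      (numbering (pops k) a) = c a := fun a => hf.extend_apply _ _ _
    have hn := hkc.relabel hf he
    refine ⟨standardize k, Function.extend (numbering (pops k)) c fun _ => false,
      ⟨hk.relabel hf, hka.relabel hf, ⟨_, hn⟩, hka.standardize⟩, hn, ?_⟩
    unfold standardize
    rw [relabel_relabel]
    congr 1
    funext a
    exact he a
  · intro g hg'
    obtain ⟨g1, hg1, rfl⟩ := List.mem_map.1 hg'
    exact ⟨g1, c, hu.of_sublist (sublist_flat_of_gap hl hg1) (hg g1 hg1),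
      hc.sublist (sublist_flat_of_gap hl hg1), rfl⟩

theorem IsValid.eq_cons_append {w : List (Bool × Bool)} (hw : IsValid w) (h : w ≠ []) :
    ∃ a a' r r', w = (true, a) :: r ∧ w = r' ++ [(false, a')] := by
  obtain ⟨u, c, hu, hc, rfl⟩ := hw
  obtain ⟨a, a', r, r', h1, h2⟩ := hu.eq_cons_append (by simpa using h)
  refine ⟨c a, c a', relabel c r, relabel c r', ?_, ?_⟩
  · conv_lhs => rw [h1]
    rfl
  · conv_lhs => rw [h2]
    simp [relabel]

/-- In a colouring without crossings, a pop right after a push has the colour of that push only if it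
has its label: otherwise the two arches cross. -/
theorem wtStep_colour (b : ℝ≥0∞) {k : List (Bool × α)} (hk : IsArch k) {c : α → Bool}
    (hc : NonCrossing c k) {p x y r} (e : k = p ++ x :: y :: r) :
    wtStep b x y = wtStep b (Prod.map id c x) (Prod.map id c y) := by
  obtain ⟨t, a⟩ := x
  obtain ⟨t', a'⟩ := y
  cases t
  · rw [wtStep_false _ _ rfl, wtStep_false _ _ rfl]
  cases t'
  swap
  · rw [wtStep_true _ _ rfl, wtStep_true _ _ rfl]
  by_cases haa : a = a'
  · simp [wtStep, haa]
  · have hca : c a' ≠ c a := by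
      intro hca
      refine hc a' a hca ?_
      have h1 : (true, a') ∈ p := by
        have : (true, a') ∈ k := (hk.closed a').2 (by rw [e]; simp)
        rw [e, List.mem_append, List.mem_cons, List.mem_cons] at this
        rcases this with h | h | h | h
        · exact h
        · simp at h; exact absurd h.symm haa
        · simp at h
        · exfalso
          refine hk.order a' ?_
          rw [e]
          exact (((List.singleton_sublist.2 h).cons_cons _).trans
            (List.sublist_cons_self _ _)).trans (List.sublist_append_right _ _)
      have h2 : (false, a) ∈ r := by
        have : (false, a) ∈ k := (hk.closed a).1 (by rw [e]; simp)
        rw [e, List.mem_append, List.mem_cons, List.mem_cons] at this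
        rcases this with h | h | h | h
        · exfalso
          refine hk.order a ?_
          rw [e]
          exact (List.singleton_sublist.2 h).append (List.singleton_sublist.2 (by simp))
        · simp at h
        · simp at h; exact absurd h haa
        · exact h
      rw [e]
      exact (List.singleton_sublist.2 h1).append
        (((List.singleton_sublist.2 h2).cons_cons _).cons_cons _)
    simp [wtStep, haa, Ne.symm hca]

open Classical in
/-- A primitive arch system has at most two colourings, one for each colour of its first letter. -/
theorem tsum_colPrim_le (s b q : ℝ≥0∞) :
    ∑' K : List (Bool × Bool), (if ColPrim K then s ^ K.length * gapProd b q K else 0) ≤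
      2 * primSum s b q := by
  have h2 : 2 * primSum s b q = ∑' p : Bool × List (Bool × ℕ),
      (if PrimArch p.2 then s ^ p.2.length * gapProd b q p.2 else 0) := by
    rw [ENNReal.tsum_prod (f := fun (_ : Bool) (k : List (Bool × ℕ)) =>
      if PrimArch k then s ^ k.length * gapProd b q k else 0), tsum_bool, two_mul]
    rfl
  rw [h2]
  have hsupp : ∀ K : List (Bool × Bool),
      (if ColPrim K then s ^ K.length * gapProd b q K else 0) ≠ 0 → ColPrim K := by
    intro K h
    by_contra hK; simp [hK] at h
  refine tsum_le_tsum_of_injOn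
    (fun K => (match K with | [] => true | z :: _ => z.2,
      if h : ColPrim K then h.choose else [])) ?_ ?_
  · intro K K' h h' e
    have hK := hsupp K h
    have hK' := hsupp K' h'
    simp only [dif_pos hK, dif_pos hK', Prod.mk.injEq] at e
    obtain ⟨e1, e2⟩ := e
    obtain ⟨c, h1, h2, h3⟩ := hK.choose_spec
    obtain ⟨c', h1', h2', h3'⟩ := hK'.choose_spec
    rw [← e2] at h1' h2' h3'
    set k := hK.choose
    obtain ⟨z, k1, hz⟩ := List.exists_cons_of_ne_nil h1.1.1
    have hcz : c z.2 = c' z.2 := by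
      rw [← h3, ← h3', hz] at e1
      simpa [relabel] using e1
    have := h1.1.colouring_unique h1.2.1 h2 h2' hz hcz
    rw [← h3, ← h3']
    refine List.map_congr_left fun x hx => ?_
    exact Prod.ext rfl (this x hx)
  · intro K h
    have hK := hsupp K h
    simp only [dif_pos hK]
    obtain ⟨c, h1, h2, h3⟩ := hK.choose_spec
    rw [if_pos h1, if_pos hK]
    set k := hK.choose
    refine le_of_eq ?_
    rw [gapProd_congr (b' := b) (Prod.map id c) k fun p x y r e => wtStep_colour b h1.2.1 h2 e]
    change _ = s ^ k.length * gapProd b q (relabel c k)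
    rw [h3, ← h3, relabel_length]

theorem gapWeight_congr_gaps {b : ℝ≥0∞} {v v' : List β → ℝ≥0∞} : ∀ {k : List (Bool × α)}
    {gs : List (List β)}, (∀ g ∈ gs, g ≠ [] → v g = v' g) →
      gapWeight b v k gs = gapWeight b v' k gs
  | [], [], _ => rfl
  | [], _ :: _, _ => rfl
  | [_], [], _ => rfl
  | [x], [g], h => by
    simp only [gapWeight]
    split_ifs with hg
    · rfl
    · exact h g (by simp) hg
  | [_], _ :: _ :: _, _ => rfl
  | _ :: _ :: _, [], _ => rfl
  | x :: y :: k, g :: gs, h => by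
    simp only [gapWeight]
    rw [gapWeight_congr_gaps (k := y :: k) (fun g' h' => h g' (by simp [h']))]
    split_ifs with hg
    · rfl
    · rw [h g (by simp) hg]

/-- The gaps of a word of length at most `N + 1` have length at most `N`. -/
theorem colSum_succ_le (s b : ℝ≥0∞) (N : ℕ) :
    colSum s b (N + 1) ≤ 2 * primSum s b (colSum s b N) := by
  classical
  refine le_trans ?_ (tsum_colPrim_le s b _)
  have h1 : ∑' K : List (Bool × Bool),
      (if ColPrim K then s ^ K.length * gapProd b (colSum s b N) K else 0) =
      ∑' p : List (Bool × Bool) × List (List (Bool × Bool)),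
      (if ColPrim p.1 then s ^ p.1.length * gapWeight b (colWeight s b N) p.1 p.2 else 0) := by
    rw [ENNReal.tsum_prod (f := fun k gs =>
      if ColPrim k then s ^ k.length * gapWeight b (colWeight s b N) k gs else 0)]
    refine tsum_congr fun k => ?_
    split_ifs with hk
    · rw [ENNReal.tsum_mul_left, tsum_gapWeight]
      congr 2
      refine tsum_congr fun u => ?_
      by_cases hu : u = []
      · simp [hu, colWeight]
      · simp [hu]
    · simp
  rw [h1]
  have hsupp : ∀ w, colWeight s b (N + 1) w ≠ 0 → w ≠ [] ∧ w.length ≤ N + 1 ∧ IsValid w := by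
    intro w h
    by_contra hw; simp [colWeight, hw] at h
  let D : List (Bool × Bool) → List (Bool × Bool) × List (List (Bool × Bool)) → Prop :=
    fun w p => ColPrim p.1 ∧ p.1.length = p.2.length ∧ flat p.1 p.2 = w ∧ ∀ g ∈ p.2, IsValid g
  have hD : ∀ w, colWeight s b (N + 1) w ≠ 0 → ∃ p, D w p := by
    intro w h
    obtain ⟨h0, -, hv⟩ := hsupp w h
    obtain ⟨K, gs, h⟩ := exists_colPrim_flat hv h0
    exact ⟨(K, gs), h⟩
  refine tsum_le_tsum_of_injOn
    (fun w => if h : ∃ p, D w p then h.choose else ([], [])) ?_ ?_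
  · intro w w' h h' e
    simp only [dif_pos (hD w h), dif_pos (hD w' h')] at e
    rw [← (hD w h).choose_spec.2.2.1, ← (hD w' h').choose_spec.2.2.1, e]
  · intro w h
    simp only [dif_pos (hD w h)]
    obtain ⟨h2, h3, h4, h5⟩ := (hD w h).choose_spec
    set p := (hD w h).choose
    obtain ⟨h0, hN, hv⟩ := hsupp w h
    rw [if_pos h2, colWeight, if_pos ⟨h0, hN, hv⟩]
    have e : wts s b w = wts s b (flat p.1 p.2) := by rw [h4]
    rw [e, wts_flat s b p.1 p.2 h3 fun g hg hne => (h5 g hg).eq_cons_append hne]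
    refine le_of_eq ?_
    congr 1
    refine gapWeight_congr_gaps ?_
    intro g hg hne
    have : g.length < w.length := by rw [← h4]; exact length_flat_of_gap h3 hg
    rw [colWeight, if_pos ⟨hne, by omega, h5 g hg⟩]

/-! ### Comparison of the two counts -/

/-- The only primitive arch system with a pop directly after the push of the same label is a single
arch. -/
theorem primitive_no_peak {k : List (Bool × ℕ)} (hk : PrimArch k) (h0 : k ≠ [(true, 0), (false, 0)])
    {p x y r} (e : k = p ++ (true, x) :: (false, y) :: r) : x ≠ y := by
  rintro rfl
  have hcl : Closed [(true, x), (false, x)] := by intro a; simp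
  have hp : p = [] := by
    by_contra hp
    have := hk.1.2 p [(true, x), (false, x)] r (by simp [e]) hp hcl
    simp at this
  subst hp
  have hr : Closed r := by
    have hn := hk.2.1.nodup
    rw [e] at hn
    simp only [List.nil_append, List.nodup_cons, List.mem_cons, not_or] at hn
    intro a
    have := hk.2.1.closed a
    rw [e] at this
    simp only [List.nil_append, List.mem_cons, Prod.mk.injEq, true_and, reduceCtorEq, false_and,
      false_or] at this
    by_cases hax : a = x
    · subst hax; simp [hn.1.2, hn.2.1]
    · simpa [hax] using this
  have hr0 : r = [] := hk.1.2 [(true, x), (false, x)] r [] (by simp [e]) (by simp) hr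
  subst hr0
  have hs := hk.2.2.2
  rw [e] at hs
  simp [Standard] at hs
  subst hs
  exact h0 e

theorem primArch_single : PrimArch [(true, 0), (false, 0)] := by
  have ha : IsArch [(true, 0), (false, 0)] := by
    refine ⟨by simp, by intro a; simp, ?_⟩
    intro a h
    have := h.eq_of_length (by simp)
    simp at this
  refine ⟨⟨by simp, ?_⟩, ha, ⟨fun _ => true, ?_⟩, by simp [Standard]⟩
  · intro x v y e hx hv
    by_contra hv0
    match x, v, e with
    | [_], [z], e =>
      simp only [List.cons_append, List.nil_append, List.cons.injEq] at e
      rw [← e.2.1] at hv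
      have := hv 0
      simp at this
    | [_], z :: z' :: v, e =>
      simp at e
    | _ :: _ :: x, z :: v, e =>
      simp at e
    | [], _, _ => exact hx rfl
    | _, [], _ => exact hv0 rfl
  · intro a b _ h
    have := h.length_le
    simp at this

open Classical in
/-- The part of `primSum` with skeletons other than a single arch. By `primitive_no_peak` it does not
depend on `b`. -/
noncomputable def primRest (s q : ℝ≥0∞) : ℝ≥0∞ :=
  ∑' k : List (Bool × ℕ), if PrimArch k ∧ k ≠ [(true, 0), (false, 0)] then
    s ^ k.length * gapProd 1 q k else 0

theorem primSum_eq (s b q : ℝ≥0∞) :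
    primSum s b q = s ^ 2 * ((b + q) * (1 + q)) + primRest s q := by
  classical
  unfold primSum primRest
  rw [ENNReal.tsum_eq_add_tsum_ite [(true, 0), (false, 0)], if_pos primArch_single]
  congr 1
  · simp [gapProd, wtStep]
  · refine tsum_congr fun k => ?_
    by_cases h0 : k = [(true, 0), (false, 0)]
    · simp [h0]
    · by_cases hk : PrimArch k
      · rw [if_neg h0, if_pos hk, if_pos ⟨hk, h0⟩]
        congr 1
        have := gapProd_congr (b := b) (b' := 1) (q := q) id k ?_
        · simpa using this
        · rintro p ⟨t, x⟩ ⟨t', y⟩ r e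
          cases t
          · rw [wtStep_false _ _ rfl, wtStep_false _ _ rfl]
          cases t'
          swap
          · rw [wtStep_true _ _ rfl, wtStep_true _ _ rfl]
          have := primitive_no_peak hk h0 e
          simp [wtStep, this]
      · simp [hk]

theorem primRest_mono (s : ℝ≥0∞) {q q' : ℝ≥0∞} (h : q ≤ q') : primRest s q ≤ primRest s q' := by
  classical
  refine ENNReal.tsum_le_tsum fun k => ?_
  split_ifs
  · have := gapProd_mono (b := 1) h k
    gcongr
  · exact le_rfl

/-- For `b` with `2 s² (1 - b) (1 + p) ≥ p`, where `p = archSum s`, the factor `2` for the two colours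
of each skeleton is compensated by the weight `b` of the innermost arches. The hypothesis avoids
subtraction in `[0, ∞]`. -/
theorem colSum_le {s b : ℝ≥0∞} (hfin : archSum s ≠ ⊤)
    (hb : archSum s + 2 * (s ^ 2 * ((b + archSum s) * (1 + archSum s))) ≤
      2 * (s ^ 2 * ((1 + archSum s) * (1 + archSum s)))) (N : ℕ) : colSum s b N ≤ archSum s := by
  induction N with
  | zero =>
    have : colSum s b 0 = 0 := by
      unfold colSum
      rw [ENNReal.tsum_eq_zero]
      intro w
      rw [colWeight, if_neg]
      rintro ⟨h, h', -⟩
      exact h (List.length_eq_zero_iff.1 (by omega))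
    rw [this]; exact zero_le
  | succ N ih =>
    have h1 := primSum_le s
    rw [primSum_eq] at h1
    have h2 := colSum_succ_le s b N
    rw [primSum_eq] at h2
    have h3 := primRest_mono s ih
    set p := archSum s
    set q := colSum s b N
    have h4 : colSum s b (N + 1) ≤ 2 * (s ^ 2 * ((b + p) * (1 + p)) + primRest s p) := by
      refine h2.trans ?_
      gcongr
    have h5 : p + colSum s b (N + 1) ≤ 2 * p := by
      calc p + colSum s b (N + 1) ≤ p + 2 * (s ^ 2 * ((b + p) * (1 + p)) + primRest s p) := by
            gcongr
        _ = (p + 2 * (s ^ 2 * ((b + p) * (1 + p)))) + 2 * primRest s p := by ring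
        _ ≤ 2 * (s ^ 2 * ((1 + p) * (1 + p))) + 2 * primRest s p := by gcongr
        _ = 2 * (s ^ 2 * ((1 + p) * (1 + p)) + primRest s p) := by ring
        _ ≤ 2 * p := by gcongr
    rw [two_mul] at h5
    exact (ENNReal.add_le_add_iff_left hfin).1 h5

/-! ### Dyck paths in the quarter plane -/

/-- The number of letters left on the stack `c` after the operations `w`. -/
def height (c : Bool) (w : List (Bool × Bool)) : ℤ := w.count (true, c) - w.count (false, c)

@[simp] theorem height_nil (c : Bool) : height c [] = 0 := by simp [height]

@[simp] theorem height_append (c : Bool) (u v : List (Bool × Bool)) :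
    height c (u ++ v) = height c u + height c v := by
  simp [height]; ring

theorem height_cons (c : Bool) (x : Bool × Bool) (v : List (Bool × Bool)) :
    height c (x :: v) = height c [x] + height c v := height_append c [x] v

/-- Sequences of operations that never pop an empty stack and leave both stacks empty. -/
structure IsDyck (w : List (Bool × Bool)) : Prop where
  total : ∀ c, height c w = 0
  nonneg : ∀ z y, w = z ++ y → ∀ c, 0 ≤ height c z

/-- A word that contains a push can be split at its last push. -/
theorem exists_last_push {w : List (Bool × α)} (h : ∃ z ∈ w, z.1 = true) :
    ∃ x c y, w = x ++ (true, c) :: y ∧ ∀ z ∈ y, z.1 = false := by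
  induction w with
  | nil => simp at h
  | cons z w ih =>
    by_cases hw : ∃ z ∈ w, z.1 = true
    · obtain ⟨x, c, y, rfl, h2⟩ := ih hw
      exact ⟨z :: x, c, y, rfl, h2⟩
    · push Not at hw
      obtain ⟨z', hz', ht⟩ := h
      rw [List.mem_cons] at hz'
      rcases hz' with rfl | hz'
      · refine ⟨[], z'.2, w, ?_, fun z hz => by simpa using hw z hz⟩
        rw [← ht]; rfl
      · exact absurd ht (hw z' hz')

theorem height_eq_neg_count {c : Bool} {w : List (Bool × Bool)} (h : ∀ z ∈ w, z.1 = false) :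
    height c w = - w.count (false, c) := by
  have : w.count (true, c) = 0 := List.count_eq_zero.2 fun h' => by simpa using h _ h'
  simp [height, this]

theorem height_remove (c c' : Bool) (x y₁ y₂ : List (Bool × Bool)) :
    height c' (x ++ (true, c) :: (y₁ ++ (false, c) :: y₂)) = height c' (x ++ y₁ ++ y₂) := by
  have e : height c' [(true, c)] + height c' [(false, c)] = 0 := by
    cases c <;> cases c' <;> simp [height]
  rw [height_append, height_cons, height_append, height_cons c' (false, c), height_append,
    height_append]
  linarith

/-- The first pop of colour `c` after the last push, itself of colour `c`, can be removed together
with this push. -/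
theorem IsDyck.remove {x y₁ y₂ : List (Bool × Bool)} {c : Bool}
    (hw : IsDyck (x ++ (true, c) :: (y₁ ++ (false, c) :: y₂)))
    (hy : ∀ z ∈ y₁, z.1 = false) (hc : (false, c) ∉ y₁) : IsDyck (x ++ y₁ ++ y₂) := by
  constructor
  · intro c'
    rw [← height_remove c]
    exact hw.total c'
  · intro z y hz c'
    rw [List.append_assoc, List.append_eq_append_iff] at hz
    rcases hz with ⟨w, rfl, h2⟩ | ⟨w, h1, -⟩
    · rw [List.append_eq_append_iff] at h2
      rcases h2 with ⟨w', rfl, h3⟩ | ⟨w', h3, h4⟩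
      · have := hw.nonneg (x ++ (true, c) :: (y₁ ++ (false, c) :: w')) y (by simp [h3]) c'
        rwa [height_remove, List.append_assoc] at this
      · by_cases hcc : c' = c
        · subst hcc
          have h5 := hw.nonneg x _ rfl c'
          have h6 : height c' w = 0 := by
            rw [height_eq_neg_count (fun z hz => hy z (by simp [h3, hz])),
              List.count_eq_zero.2 fun h => hc (by simp [h3, h])]
            simp
          rw [height_append]; linarith
        · have h5 := hw.nonneg (x ++ (true, c) :: w) (w' ++ (false, c) :: y₂) (by simp [h3]) c'
          have h6 : height c' [(true, c)] = 0 := by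
            revert hcc; cases c <;> cases c' <;> simp [height]
          rw [height_append, height_cons, h6] at h5
          rw [height_append]
          linarith
    · exact hw.nonneg z (w ++ (true, c) :: (y₁ ++ (false, c) :: y₂)) (by simp [h1]) c'

/-- An arch with the new label `e` can be inserted; words that avoid `e`, and words that consist of
letters `e` only, occur in the result as they do in the two parts. -/
theorem isArch_insert_arc {x y₁ y₂ : List (Bool × α)} (hu : IsArch (x ++ y₁ ++ y₂)) {e : α}
    (he : ∀ t, (t, e) ∉ x ++ y₁ ++ y₂) :
    IsArch (x ++ (true, e) :: (y₁ ++ (false, e) :: y₂)) ∧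
    (∀ l : List (Bool × α), (∀ z ∈ l, z.2 ≠ e) →
      l.Sublist (x ++ (true, e) :: (y₁ ++ (false, e) :: y₂)) → l.Sublist (x ++ y₁ ++ y₂)) ∧
    (∀ l : List (Bool × α), (∀ z ∈ l, z.2 = e) →
      l.Sublist (x ++ (true, e) :: (y₁ ++ (false, e) :: y₂)) →
      l.Sublist [(true, e), (false, e)]) := by
  classical
  have hne : ∀ z ∈ x ++ y₁ ++ y₂, z.2 ≠ e := by
    rintro ⟨t, a⟩ hz rfl; exact he t hz
  have hx : ∀ z ∈ x, z.2 ≠ e := fun z hz => hne z (by simp [hz])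
  have hy₁ : ∀ z ∈ y₁, z.2 ≠ e := fun z hz => hne z (by simp [hz])
  have hy₂ : ∀ z ∈ y₂, z.2 ≠ e := fun z hz => hne z (by simp [hz])
  have f1 : ∀ l : List (Bool × α), (∀ z ∈ l, z.2 ≠ e) →
      l.filter (fun z => decide (z.2 ≠ e)) = l := fun l hl => List.filter_eq_self.2
        fun z hz => by simpa using hl z hz
  have f2 : ∀ l : List (Bool × α), (∀ z ∈ l, z.2 ≠ e) →
      l.filter (fun z => decide (z.2 = e)) = [] := fun l hl => List.filter_eq_nil_iff.2
        fun z hz => by simpa using hl z hz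
  have g1 : ∀ l : List (Bool × α), (∀ z ∈ l, z.2 ≠ e) →
      l.Sublist (x ++ (true, e) :: (y₁ ++ (false, e) :: y₂)) → l.Sublist (x ++ y₁ ++ y₂) := by
    intro l hl h
    have := h.filter (fun z => decide (z.2 ≠ e))
    rw [f1 l hl, List.filter_append, List.filter_cons_of_neg (by simp), List.filter_append,
      List.filter_cons_of_neg (by simp), f1 x hx, f1 y₁ hy₁, f1 y₂ hy₂] at this
    simpa using this
  have g2 : ∀ l : List (Bool × α), (∀ z ∈ l, z.2 = e) →
      l.Sublist (x ++ (true, e) :: (y₁ ++ (false, e) :: y₂)) →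
      l.Sublist [(true, e), (false, e)] := by
    intro l hl h
    have := h.filter (fun z => decide (z.2 = e))
    rw [List.filter_eq_self.2 (fun z hz => by simpa using hl z hz), List.filter_append,
      List.filter_cons_of_pos (by simp), List.filter_append,
      List.filter_cons_of_pos (by simp), f2 x hx, f2 y₁ hy₁, f2 y₂ hy₂] at this
    simpa using this
  refine ⟨⟨?_, ?_, ?_⟩, g1, g2⟩
  · have h1 : ((true, e) :: (false, e) :: (x ++ y₁ ++ y₂)).Nodup := by
      rw [List.nodup_cons, List.nodup_cons]
      refine ⟨?_, he false, hu.nodup⟩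
      rw [List.mem_cons]
      rintro (h | h)
      · simp at h
      · exact he true h
    refine (List.Perm.nodup_iff ?_).1 h1
    rw [List.perm_iff_count]
    intro a
    simp only [List.count_cons, List.count_append]
    omega
  · intro a
    have := hu.closed a
    simp only [List.mem_append, List.mem_cons, Prod.mk.injEq, true_and, reduceCtorEq, false_and,
      false_or] at this ⊢
    tauto
  · intro a h
    by_cases hae : a = e
    · subst hae
      have := (g2 _ (by simp) h).eq_of_length rfl
      simp at this
    · exact hu.order a (g1 _ (by simp [hae]) h)

/-- The arches are found by induction: match the last push with the first later pop of its colour. -/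
theorem IsDyck.isValid (n : ℕ) : ∀ w : List (Bool × Bool), w.length ≤ n → IsDyck w → IsValid w := by
  classical
  induction n with
  | zero =>
    intro w hw _
    rw [List.length_eq_zero_iff.1 (Nat.le_zero.1 hw)]
    exact ⟨[], fun _ => true, IsArch.nil, fun a b _ h => by simp at h, rfl⟩
  | succ n ih =>
    intro w hn hw
    by_cases h0 : w = []
    · rw [h0]
      exact ⟨[], fun _ => true, IsArch.nil, fun a b _ h => by simp at h, rfl⟩
    obtain ⟨x, c, y, rfl, hy⟩ := exists_last_push (w := w) (by
      obtain ⟨⟨t, a⟩, w', rfl⟩ := List.exists_cons_of_ne_nil h0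
      refine ⟨_, List.mem_cons_self, ?_⟩
      by_contra ht
      have ht' : t = false := by simpa using ht
      have := hw.nonneg [(t, a)] w' rfl a
      rw [ht'] at this
      simp [height] at this)
    have hFc : (false, c) ∈ y := by
      by_contra hF
      have h1 := hw.total c
      have h2 := hw.nonneg x _ rfl c
      have h3 : height c y = 0 := by
        rw [height_eq_neg_count hy, List.count_eq_zero.2 hF]; simp
      rw [height_append, height_cons, h3] at h1
      have h4 : height c [(true, c)] = 1 := by simp [height]
      linarith
    obtain ⟨y₁, y₂, rfl, hy₁⟩ := List.eq_append_cons_of_mem hFc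
    have hy₁' : ∀ z ∈ y₁, z.1 = false := fun z hz => hy z (by simp [hz])
    obtain ⟨u, c', hu, hc', e⟩ := ih (x ++ y₁ ++ y₂) (by simp at hn ⊢; omega)
      (hw.remove hy₁' hy₁)
    obtain ⟨u', uy₂, rfl, e', rfl⟩ := List.map_eq_append_iff.1 e
    obtain ⟨ux, uy₁, rfl, rfl, rfl⟩ := List.map_eq_append_iff.1 e'
    obtain ⟨l, hl⟩ := Infinite.exists_notMem_finset ((ux ++ uy₁ ++ uy₂).map Prod.snd).toFinset
    have hl' : ∀ t, (t, l) ∉ ux ++ uy₁ ++ uy₂ := by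
      intro t h
      exact hl (List.mem_toFinset.2 (List.mem_map_of_mem (f := Prod.snd) h))
    obtain ⟨ha, g1, g2⟩ := isArch_insert_arc hu hl'
    refine ⟨_, Function.update c' l c, ha, ?_, ?_⟩
    · intro a b hab h
      by_cases hal : a = l <;> by_cases hbl : b = l
      · subst hal hbl
        have := (g2 _ (by simp) h).length_le
        simp at this
      · subst hal
        have h1 : [(true, a), (true, b), (false, a)].Sublist
            (ux ++ (true, a) :: (uy₁ ++ [(false, a)]) ++ uy₂) := by
          have h2 := (List.sublist_append_left [(true, a), (true, b), (false, a)]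
            [(false, b)]).trans h
          simpa using h2
        have h3 := mem_of_sublist_between h1 (fun h => hl' true (by simp [h]))
          (fun h => hl' false (by simp [h]))
        simp only [List.mem_cons, Prod.mk.injEq, true_and, hbl, false_or, List.mem_append,
          List.not_mem_nil, or_false, reduceCtorEq, false_and] at h3
        have := hy₁' _ (List.mem_map_of_mem (f := Prod.map id c') h3)
        simp at this
      · subst hbl
        have h1 : [(true, b), (false, a), (false, b)].Sublist
            (ux ++ (true, b) :: (uy₁ ++ [(false, b)]) ++ uy₂) := by
          have h2 := (List.sublist_cons_self _ _).trans h
          simpa using h2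
        have h3 := mem_of_sublist_between h1 (fun h => hl' true (by simp [h]))
          (fun h => hl' false (by simp [h]))
        simp only [List.mem_cons, Prod.mk.injEq, hal, false_or, List.mem_append,
          List.not_mem_nil, or_false, reduceCtorEq, and_false] at h3
        rw [Function.update_self, Function.update_of_ne hal] at hab
        refine hy₁ ?_
        rw [← hab]
        exact List.mem_map_of_mem (f := Prod.map id c') h3
      · rw [Function.update_of_ne hal, Function.update_of_ne hbl] at hab
        exact hc' a b hab (g1 _ (by simp [hal, hbl]) h)
    · have hm : ∀ v : List (Bool × ℕ), (∀ t, (t, l) ∉ v) →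
          v.map (Prod.map id (Function.update c' l c)) = v.map (Prod.map id c') := by
        intro v hv
        refine List.map_congr_left ?_
        rintro ⟨t, a⟩ h
        have : a ≠ l := by rintro rfl; exact hv t h
        simp [this]
      simp only [relabel, List.map_append, List.map_cons, Prod.map_apply, id_eq,
        Function.update_self]
      rw [hm ux fun t h => hl' t (by simp [h]), hm uy₁ fun t h => hl' t (by simp [h]),
        hm uy₂ fun t h => hl' t (by simp [h])]

/-! ### Growth of the number of coloured words -/

open Classical in
/-- The total weight of all nonempty valid coloured words. -/
noncomputable def validSum (s b : ℝ≥0∞) : ℝ≥0∞ :=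
  ∑' w : List (Bool × Bool), if w ≠ [] ∧ IsValid w then wts s b w else 0

theorem validSum_le {s b p : ℝ≥0∞} (h : ∀ N, colSum s b N ≤ p) : validSum s b ≤ p := by
  classical
  unfold validSum
  rw [ENNReal.tsum_eq_iSup_sum]
  refine iSup_le fun t => ?_
  refine le_trans ?_ (h (t.sup List.length))
  refine le_trans (Finset.sum_le_sum fun w hw => ?_) (ENNReal.sum_le_tsum t)
  split_ifs with h1
  · rw [colWeight, if_pos ⟨h1.1, Finset.le_sup (f := List.length) hw, h1.2⟩]
  · exact zero_le

/-- The word read backwards with pushes and pops exchanged. It negates the heights and preserves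
the weights. -/
def rev (u : List (Bool × α)) : List (Bool × α) := (u.map fun x => (!x.1, x.2)).reverse

@[simp] theorem rev_length (u : List (Bool × α)) : (rev u).length = u.length := by simp [rev]

theorem rev_rev (u : List (Bool × α)) : rev (rev u) = u := by
  simp [rev, List.map_reverse, Function.comp_def]

theorem rev_append (u v : List (Bool × α)) : rev (u ++ v) = rev v ++ rev u := by simp [rev]

theorem rev_cons (x : Bool × α) (v : List (Bool × α)) : rev (x :: v) = rev v ++ [(!x.1, x.2)] := by
  simp [rev]

theorem wt_rev (b : ℝ≥0∞) : ∀ u : List (Bool × α), wt b (rev u) = wt b u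
  | [] => by simp [rev]
  | [x] => by simp [rev]
  | x :: y :: r => by
    have ih := wt_rev b (y :: r)
    rw [rev_cons] at ih
    rw [rev_cons, rev_cons, List.append_assoc, List.singleton_append, wt_append, ih, wt_cons_cons,
      wt_singleton, mul_one, mul_comm]
    congr 1
    obtain ⟨t, a⟩ := x
    obtain ⟨t', a'⟩ := y
    by_cases h : a = a'
    · subst h
      cases t <;> cases t' <;> simp [wtStep]
    · cases t <;> cases t' <;> simp [wtStep, h, Ne.symm h]

theorem wts_rev (s b : ℝ≥0∞) (u : List (Bool × α)) : wts s b (rev u) = wts s b u := by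
  simp [wts, wt_rev]

theorem height_rev (c : Bool) (u : List (Bool × Bool)) : height c (rev u) = - height c u := by
  induction u with
  | nil => simp [rev]
  | cons x u ih =>
    rw [rev_cons, height_append, ih, height_cons c x]
    obtain ⟨_ | _, a⟩ := x <;> cases a <;> cases c <;> simp [height]

/-- Words of length `m` that begin with a push and end with a pop. The weight of a concatenation of
blocks is the product of their weights. -/
structure Block (m : ℕ) (u : List (Bool × α)) : Prop where
  length : u.length = m
  head : ∃ a r, u = (true, a) :: r
  last : ∃ r a, u = r ++ [(false, a)]

theorem Block.rev {m : ℕ} {u : List (Bool × α)} (hu : Block m u) : Block m (rev u) := by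
  obtain ⟨h, ⟨a, r, e⟩, ⟨r', a', e'⟩⟩ := hu
  refine ⟨by simpa using h, ⟨a', TwoStacks.rev r', ?_⟩, ⟨TwoStacks.rev r, a, ?_⟩⟩
  · rw [e', rev_append]; simp [TwoStacks.rev]
  · rw [e, rev_cons]; simp

theorem wts_append_of_last (s b : ℝ≥0∞) {u : List (Bool × α)} (hu : ∃ r a, u = r ++ [(false, a)])
    (v : List (Bool × α)) : wts s b (u ++ v) = wts s b u * wts s b v := by
  obtain ⟨r, a, rfl⟩ := hu
  simp only [wts, List.length_append, pow_add]
  rw [List.append_assoc, List.singleton_append, wt_append_of_false]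
  ring

theorem wts_append_of_head (s b : ℝ≥0∞) (u : List (Bool × α)) {v : List (Bool × α)}
    (hv : ∃ a r, v = (true, a) :: r) : wts s b (u ++ v) = wts s b u * wts s b v := by
  obtain ⟨a, r, rfl⟩ := hv
  simp only [wts, List.length_append, pow_add]
  rw [wt_append_of_true]
  ring

open Classical in
/-- The total weight of the blocks of length `m` with final heights `d`, which may be negative. -/
noncomputable def blockSum (s b : ℝ≥0∞) (m : ℕ) (d : ℤ × ℤ) : ℝ≥0∞ :=
  ∑' u : List (Bool × Bool),
    if Block m u ∧ (height true u, height false u) = d then wts s b u else 0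

/-- Concatenations of `k` factors `u ++ rev u'` with blocks `u` and `u'` of length `m` that have the
same final heights `d`. The heights return to `0` after each factor, so they stay above `-2 m`. -/
inductive Chain (m : ℕ) (d : ℤ × ℤ) : ℕ → List (Bool × Bool) → Prop
  | nil : Chain m d 0 []
  | cons {k u u' w} : Block m u → (height true u, height false u) = d → Block m u' →
      (height true u', height false u') = d → Chain m d k w → Chain m d (k + 1) (u ++ (rev u' ++ w))

open Classical in
/-- The total weight of the chains of `k` factors. -/
noncomputable def chainSum (s b : ℝ≥0∞) (m : ℕ) (d : ℤ × ℤ) (k : ℕ) : ℝ≥0∞ :=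
  ∑' w : List (Bool × Bool), if Chain m d k w then wts s b w else 0

theorem chainSum_succ (s b : ℝ≥0∞) (m : ℕ) (d : ℤ × ℤ) (k : ℕ) :
    blockSum s b m d ^ 2 * chainSum s b m d k ≤ chainSum s b m d (k + 1) := by
  classical
  let F : List (Bool × Bool) → ℝ≥0∞ := fun u =>
    if Block m u ∧ (height true u, height false u) = d then wts s b u else 0
  let G : List (Bool × Bool) → ℝ≥0∞ := fun w => if Chain m d k w then wts s b w else 0
  have h1 : blockSum s b m d ^ 2 * chainSum s b m d k =
      ∑' p : List (Bool × Bool) × List (Bool × Bool) × List (Bool × Bool),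
        F p.1 * (F p.2.1 * G p.2.2) := by
    rw [ENNReal.tsum_prod (f := fun u (q : List (Bool × Bool) × List (Bool × Bool)) =>
      F u * (F q.1 * G q.2))]
    simp only [ENNReal.tsum_mul_left]
    rw [ENNReal.tsum_mul_right, ENNReal.tsum_prod (f := fun u w => F u * G w)]
    simp only [ENNReal.tsum_mul_left]
    rw [ENNReal.tsum_mul_right, sq, mul_assoc]
    rfl
  rw [h1]
  have hF : ∀ u, F u ≠ 0 → Block m u ∧ (height true u, height false u) = d := by
    intro u h; by_contra h'; simp [F, h'] at h
  have hG : ∀ w, G w ≠ 0 → Chain m d k w := by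
    intro w h; by_contra h'; simp [G, h'] at h
  have hne : ∀ u u' w, F u * (F u' * G w) ≠ 0 → F u ≠ 0 ∧ F u' ≠ 0 ∧ G w ≠ 0 := by
    intro u u' w h
    obtain ⟨h1, h2⟩ := mul_ne_zero_iff.1 h
    obtain ⟨h2, h3⟩ := mul_ne_zero_iff.1 h2
    exact ⟨h1, h2, h3⟩
  refine tsum_le_tsum_of_injOn (fun p => p.1 ++ (rev p.2.1 ++ p.2.2)) ?_ ?_
  · rintro ⟨u, u', w⟩ ⟨v, v', w'⟩ h h' e
    obtain ⟨h1, h2, h3⟩ := hne _ _ _ h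
    obtain ⟨h1', h2', h3'⟩ := hne _ _ _ h'
    obtain ⟨e1, e2⟩ := List.append_inj e ((hF _ h1).1.length.trans (hF _ h1').1.length.symm)
    obtain ⟨e3, e4⟩ := List.append_inj e2
      ((hF _ h2).1.rev.length.trans (hF _ h2').1.rev.length.symm)
    have e5 : u' = v' := by rw [← rev_rev u', e3, rev_rev]
    exact Prod.ext e1 (Prod.ext e5 e4)
  · rintro ⟨u, u', w⟩ h
    obtain ⟨h1, h2, h3⟩ := hne _ _ _ h
    have a1 := hF _ h1
    have a2 := hF _ h2
    have a3 := hG _ h3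
    simp only [F, G, if_pos a1, if_pos a2, if_pos a3]
    rw [if_pos (Chain.cons a1.1 a1.2 a2.1 a2.2 a3), wts_append_of_last s b a1.1.last,
      wts_append_of_last s b a2.1.rev.last, wts_rev]

theorem blockSum_pow_le_chainSum (s b : ℝ≥0∞) (m : ℕ) (d : ℤ × ℤ) (k : ℕ) :
    (blockSum s b m d ^ 2) ^ k ≤ chainSum s b m d k := by
  classical
  induction k with
  | zero =>
    refine le_trans ?_ (ENNReal.le_tsum ([] : List (Bool × Bool)))
    rw [if_pos Chain.nil]
    simp [wts]
  | succ k ih =>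
    rw [pow_succ']
    refine le_trans ?_ (chainSum_succ s b m d k)
    gcongr

theorem neg_length_le_height (c : Bool) (w : List (Bool × Bool)) :
    -(w.length : ℤ) ≤ height c w := by
  have := List.count_le_length (a := (false, c)) (l := w)
  simp only [height]
  omega

theorem Chain.height_eq {m d k w} (h : Chain m d k w) (c : Bool) : height c w = 0 := by
  induction h with
  | nil => simp
  | cons h1 h2 h3 h4 _ ih =>
    rw [height_append, height_append, ih, height_rev]
    have := h2.trans h4.symm
    simp only [Prod.mk.injEq] at this
    cases c <;> simp [this.1, this.2]

theorem Chain.le_height {m d k w} (h : Chain m d k w) (c : Bool) :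
    ∀ z y, w = z ++ y → -(2 * m : ℤ) ≤ height c z := by
  induction h with
  | nil =>
    intro z y e
    have : z = [] := (List.append_eq_nil_iff.1 e.symm).1
    simp [this]
  | @cons k u u' w h1 h2 h3 h4 hc ih =>
    intro z y e
    rw [← List.append_assoc, List.append_eq_append_iff] at e
    rcases e with ⟨t, rfl, e⟩ | ⟨t, e, -⟩
    · have h5 := ih t y e
      have : height c (u ++ rev u') = 0 := by
        rw [height_append, height_rev]
        have := h2.trans h4.symm
        simp only [Prod.mk.injEq] at this
        cases c <;> simp [this.1, this.2]
      rw [height_append, this]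
      linarith
    · have h5 := neg_length_le_height c z
      have h6 := congrArg List.length e
      simp only [List.length_append, rev_length, h1.length, h3.length] at h6
      have : z.length ≤ 2 * m := by omega
      have : (z.length : ℤ) ≤ 2 * m := by exact_mod_cast this
      linarith

theorem Chain.head {m d k w} (h : Chain m d (k + 1) w) : ∃ a r, w = (true, a) :: r := by
  cases h with
  | cons h1 h2 h3 h4 _ =>
    obtain ⟨a, r, rfl⟩ := h1.head
    exact ⟨a, _, rfl⟩

theorem Chain.last {m d k w} (h : Chain m d (k + 1) w) : ∃ r a, w = r ++ [(false, a)] := by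
  cases k with
  | zero =>
    cases h with
    | cons h1 h2 h3 h4 h =>
      cases h
      obtain ⟨r, a, e⟩ := h3.rev.last
      exact ⟨_, a, by rw [e, List.append_nil, ← List.append_assoc]⟩
  | succ k =>
    cases h with
    | cons h1 h2 h3 h4 h =>
      obtain ⟨r, a, e⟩ := h.last
      exact ⟨_, a, by rw [e, ← List.append_assoc, ← List.append_assoc]⟩

theorem wt_eq_one_of_pushes (b : ℝ≥0∞) : ∀ u : List (Bool × α), (∀ z ∈ u, z.1 = true) → wt b u = 1
  | [], _ => by simp
  | [x], _ => by simp
  | x :: y :: r, h => by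
    rw [wt_cons_cons, wtStep_true _ _ (h y (by simp)),
      wt_eq_one_of_pushes b (y :: r) (fun z hz => h z (by simp [hz])), mul_one]

/-- A word that raises both heights to `m`. -/
def ramp (m : ℕ) : List (Bool × Bool) :=
  List.replicate m (true, true) ++ List.replicate m (true, false)

theorem height_ramp (c : Bool) (m : ℕ) : height c (ramp m) = m := by
  cases c <;> simp [ramp, height, List.count_replicate]

theorem ramp_push (m : ℕ) : ∀ z ∈ ramp m, z.1 = true := by
  intro z hz
  simp only [ramp, List.mem_append, List.mem_replicate] at hz
  rcases hz with ⟨-, rfl⟩ | ⟨-, rfl⟩ <;> rfl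

/-- After a ramp, a chain no longer pops an empty stack. -/
theorem Chain.isDyck {m d k w} (h : Chain m d k w) :
    IsDyck (ramp (2 * m) ++ w ++ rev (ramp (2 * m))) := by
  have hpush : ∀ (c : Bool) (z : List (Bool × Bool)), (∀ x ∈ z, x.1 = true) → 0 ≤ height c z := by
    intro c z hz
    have : z.count (false, c) = 0 := List.count_eq_zero.2 fun h' => by simpa using hz _ h'
    simp [height, this]
  constructor
  · intro c
    rw [height_append, height_append, height_rev, h.height_eq, height_ramp]
    ring
  · intro z y e c
    rw [List.append_assoc, List.append_eq_append_iff] at e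
    rcases e with ⟨t, rfl, e⟩ | ⟨t, e, -⟩
    · rw [List.append_eq_append_iff] at e
      rcases e with ⟨t', rfl, e⟩ | ⟨t', e, -⟩
      · have h1 : height c t' + height c y = -((2 * m : ℕ) : ℤ) := by
          rw [← height_append, ← e, height_rev, height_ramp]
        have h2 : height c y ≤ 0 := by
          have h3 : ∀ x ∈ y, x.1 = false := by
            intro x hx
            have : x ∈ rev (ramp (2 * m)) := by rw [e]; simp [hx]
            simp only [rev, List.mem_reverse, List.mem_map] at this
            obtain ⟨x', hx', rfl⟩ := this
            simp [ramp_push _ _ hx']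
          rw [height_eq_neg_count h3]
          simp
        rw [height_append, height_append, height_ramp, h.height_eq]
        linarith
      · have := h.le_height c t t' e
        rw [height_append, height_ramp]
        push_cast
        linarith
    · exact hpush c z fun x hx => ramp_push (2 * m) x (by rw [e]; simp [hx])

theorem chainSum_le_validSum (s b : ℝ≥0∞) (m : ℕ) (d : ℤ × ℤ) (k : ℕ) :
    (s ^ (2 * (4 * m))) * chainSum s b m d (k + 1) ≤ validSum s b := by
  classical
  unfold chainSum validSum
  rw [← ENNReal.tsum_mul_left]
  refine tsum_le_tsum_of_injOn (fun w => ramp (2 * m) ++ w ++ rev (ramp (2 * m))) ?_ ?_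
  · intro w w' _ _ e
    simpa using e
  · intro w hw
    have hc : Chain m d (k + 1) w := by
      by_contra h; simp [h] at hw
    obtain ⟨a, r, e⟩ := hc.head
    rw [if_pos hc, if_pos ⟨by simp [e], IsDyck.isValid _ _ le_rfl hc.isDyck⟩]
    have hl : ∃ r a, ramp (2 * m) ++ w = r ++ [(false, a)] := by
      obtain ⟨r, a, e⟩ := hc.last
      exact ⟨_, a, by rw [e, ← List.append_assoc]⟩
    rw [wts_append_of_last s b hl, wts_append_of_head s b _ hc.head, wts_rev]
    have : wts s b (ramp (2 * m)) = s ^ (4 * m) := by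
      rw [wts, wt_eq_one_of_pushes b _ (ramp_push _), mul_one]
      congr 1
      simp [ramp]; ring
    rw [this, two_mul, pow_add]
    refine le_of_eq ?_
    ring

/-- The weights of chains are powers of `blockSum s b m d ^ 2`, up to a factor independent of the
number of blocks, so they can only stay bounded if this number is at most `1`. -/
theorem blockSum_le_one {s b : ℝ≥0∞} (hs : s ≠ 0) (hfin : validSum s b ≠ ⊤) (m : ℕ) (d : ℤ × ℤ) :
    blockSum s b m d ≤ 1 := by
  by_contra! h
  have h1 : 1 < blockSum s b m d ^ 2 := one_lt_pow₀ h two_ne_zero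
  have h2 := (ENNReal.tendsto_pow_atTop_nhds_top_iff (r := blockSum s b m d ^ 2)).2 h1
  have h3 : s ^ (2 * (4 * m)) ≠ 0 := pow_ne_zero _ hs
  have h4 : ∀ k, (blockSum s b m d ^ 2) ^ (k + 1) ≤ validSum s b / s ^ (2 * (4 * m)) := by
    intro k
    by_cases ht : s ^ (2 * (4 * m)) = ⊤
    · exfalso
      have h5 := (mul_le_mul_right (blockSum_pow_le_chainSum s b m d (k + 1)) _).trans
        (chainSum_le_validSum s b m d k)
      rw [ht, ENNReal.top_mul] at h5
      · exact hfin (top_le_iff.1 h5)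
      · exact pow_ne_zero _ (pow_ne_zero _ (zero_lt_one.trans h).ne')
    · rw [ENNReal.le_div_iff_mul_le (Or.inl h3) (Or.inl ht), mul_comm]
      exact (mul_le_mul_right (blockSum_pow_le_chainSum s b m d (k + 1)) _).trans
        (chainSum_le_validSum s b m d k)
  have h5 : (⊤ : ℝ≥0∞) ≤ validSum s b / s ^ (2 * (4 * m)) :=
    le_of_tendsto (h2.comp (Filter.tendsto_add_atTop_nat 1)) (Filter.Eventually.of_forall h4)
  rw [top_le_iff, ENNReal.div_eq_top] at h5
  rcases h5 with ⟨-, h5⟩ | ⟨h5, -⟩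
  · exact h3 h5
  · exact hfin h5

open Classical in
/-- There are at most `(2 m + 1) ^ 2` possibilities for the final heights of a block of length `m`. -/
theorem tsum_block_le {s b : ℝ≥0∞} (m : ℕ) (h : ∀ d, blockSum s b m d ≤ 1) :
    ∑' u : List (Bool × Bool), (if Block m u then wts s b u else 0) ≤ ((2 * m + 1) ^ 2 : ℕ) := by
  let D : Finset (ℤ × ℤ) := Finset.Icc (-(m : ℤ)) m ×ˢ Finset.Icc (-(m : ℤ)) m
  have hD : D.card = (2 * m + 1) ^ 2 := by
    simp only [D, Finset.card_product, Int.card_Icc]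
    rw [sq]
    congr 1 <;> omega
  have hmem : ∀ u : List (Bool × Bool), Block m u → (height true u, height false u) ∈ D := by
    intro u hu
    have h1 := fun c => neg_length_le_height c u
    have h2 : ∀ c, height c u ≤ u.length := by
      intro c
      have := List.count_le_length (a := (true, c)) (l := u)
      simp only [height]
      omega
    rw [hu.length] at h1 h2
    simp [D, h1, h2]
  calc ∑' u : List (Bool × Bool), (if Block m u then wts s b u else 0)
      ≤ ∑' u : List (Bool × Bool), ∑ d ∈ D,
          (if Block m u ∧ (height true u, height false u) = d then wts s b u else 0) := by
        refine ENNReal.tsum_le_tsum fun u => ?_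
        by_cases hu : Block m u
        · rw [if_pos hu]
          refine le_trans (le_of_eq ?_) (Finset.single_le_sum
            (f := fun d => if Block m u ∧ (height true u, height false u) = d then wts s b u else 0)
            (fun _ _ => zero_le) (hmem u hu))
          simp [hu]
        · simp [hu]
    _ = ∑ d ∈ D, blockSum s b m d := Summable.tsum_finsetSum fun _ _ => ENNReal.summable
    _ ≤ ∑ d ∈ D, 1 := Finset.sum_le_sum fun d _ => h d
    _ = ((2 * m + 1) ^ 2 : ℕ) := by simp [hD]

open Classical in
/-- The total weight of the words `x :: w` that end with a pop, with `w` of length `r`. -/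
noncomputable def endSum (b : ℝ≥0∞) (r : ℕ) (x : Bool × Bool) : ℝ≥0∞ :=
  ∑' w : List (Bool × Bool),
    if w.length = r ∧ ∃ v a, x :: w = v ++ [(false, a)] then wt b (x :: w) else 0

theorem endSum_zero (b : ℝ≥0∞) (a : Bool) : 1 ≤ endSum b 0 (false, a) := by
  classical
  refine le_trans ?_ (ENNReal.le_tsum ([] : List (Bool × Bool)))
  rw [if_pos ⟨rfl, [], a, rfl⟩]
  simp

theorem endSum_succ (b : ℝ≥0∞) (r : ℕ) (x : Bool × Bool) :
    endSum b (r + 1) x = ∑ y, wtStep b x y * endSum b r y := by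
  classical
  unfold endSum
  rw [tsum_list, ← tsum_fintype (L := SummationFilter.unconditional _)]
  simp only [List.length_nil, List.length_cons, Nat.add_right_cancel_iff]
  rw [if_neg (by omega), zero_add]
  refine tsum_congr fun y => ?_
  rw [← ENNReal.tsum_mul_left]
  refine tsum_congr fun w => ?_
  have : (∃ v a, x :: y :: w = v ++ [(false, a)]) ↔ ∃ v a, y :: w = v ++ [(false, a)] := by
    constructor
    · rintro ⟨v, a, e⟩
      cases v with
      | nil => simp at e
      | cons z v => exact ⟨v, a, (List.cons.inj e).2⟩
    · rintro ⟨v, a, e⟩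
      exact ⟨x :: v, a, by rw [e]; rfl⟩
  rw [this, wt_cons_cons]
  split_ifs <;> simp

/-- The transfer matrix of the weights maps pushes to two pushes and a pop of weight `b`, and pops to
two pushes and two pops. With `b = β²` and `k = √2`, its leading eigenvalue is `2 + k β`, with
eigenvector `β` on pushes and `k` on pops. -/
theorem le_endSum {b β k : ℝ≥0∞} (hb : b = β * β) (hk : k * k = 2) (hβ : β ≤ k) (r : ℕ) :
    ∀ x : Bool × Bool, β * (2 + k * β) ^ r * (if x.1 then β else k) ≤ endSum b (r + 1) x := by
  have hsum : ∀ (f : Bool × Bool → ℝ≥0∞), ∑ y, f y =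
      f (true, true) + f (true, false) + (f (false, true) + f (false, false)) := by
    intro f
    rw [Fintype.sum_prod_type]
    simp
  induction r with
  | zero =>
    intro x
    rw [endSum_succ, hsum]
    have h1 := endSum_zero b true
    have h2 := endSum_zero b false
    obtain ⟨_ | _, a⟩ := x
    · simp only [wtStep_false, one_mul]
      calc _ = β * k := by simp
        _ ≤ k * k := by gcongr
        _ = 1 + 1 := by rw [hk]; norm_num
        _ ≤ endSum b 0 (false, true) + endSum b 0 (false, false) := by gcongr
        _ ≤ _ := le_add_self
    · calc _ = b * 1 := by simp [hb]
        _ ≤ b * endSum b 0 (false, a) := by gcongr; cases a <;> assumption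
        _ ≤ _ := by
          refine le_trans ?_ le_add_self
          cases a <;> simp [wtStep]
  | succ r ih =>
    intro x
    rw [endSum_succ, hsum]
    have h1 := ih (true, true)
    have h2 := ih (true, false)
    have h3 := ih (false, true)
    have h4 := ih (false, false)
    simp only [if_true, Bool.false_eq_true, if_false] at h1 h2 h3 h4
    obtain ⟨_ | _, a⟩ := x
    · simp only [wtStep_false, one_mul, Bool.false_eq_true, if_false]
      refine le_trans (le_of_eq ?_) (add_le_add (add_le_add h1 h2) (add_le_add h3 h4))
      rw [pow_succ]
      calc β * ((2 + k * β) ^ r * (2 + k * β)) * k =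
          β * (2 + k * β) ^ r * (2 * k + (k * k) * β) := by ring
        _ = _ := by rw [hk]; ring
    · have e : wtStep b (true, a) (false, true) * endSum b (r + 1) (false, true) +
          wtStep b (true, a) (false, false) * endSum b (r + 1) (false, false) =
          b * endSum b (r + 1) (false, a) := by
        cases a <;> simp [wtStep]
      rw [e, wtStep_true _ _ rfl, wtStep_true _ _ rfl, one_mul, one_mul]
      simp only [if_true]
      have h5 : β * (2 + k * β) ^ r * k ≤ endSum b (r + 1) (false, a) := by cases a <;> assumption
      refine le_trans (le_of_eq ?_) (add_le_add (add_le_add h1 h2) (mul_le_mul_right h5 b))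
      rw [pow_succ, hb]
      ring

theorem growth_bound {s b β k : ℝ≥0∞} (hs : s ≠ 0) (hfin : validSum s b ≠ ⊤) (hb : b = β * β)
    (hk : k * k = 2) (hβ : β ≤ k) (r : ℕ) :
    s ^ 2 * β ^ 2 * (s * (2 + k * β)) ^ r ≤ ((2 * (r + 2) + 1) ^ 2 : ℕ) := by
  classical
  refine le_trans ?_ (tsum_block_le (s := s) (b := b) (r + 2)
    fun d => blockSum_le_one hs hfin (r + 2) d)
  have h1 := le_endSum hb hk hβ r (true, true)
  calc s ^ 2 * β ^ 2 * (s * (2 + k * β)) ^ r =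
        s ^ (r + 2) * (β * (2 + k * β) ^ r * β) := by rw [mul_pow, pow_add]; ring
    _ ≤ s ^ (r + 2) * endSum b (r + 1) (true, true) := by gcongr; simpa using h1
    _ ≤ _ := by
      unfold endSum
      rw [← ENNReal.tsum_mul_left]
      refine tsum_le_tsum_of_injOn (fun w => (true, true) :: w) (by simp) ?_
      intro w hw
      have h : w.length = r + 1 ∧ ∃ v a, (true, true) :: w = v ++ [(false, a)] := by
        by_contra h; simp only [if_neg h, mul_zero, ne_eq, not_true_eq_false] at hw
      rw [if_pos h, if_pos ⟨by simp [h.1], ⟨true, w, rfl⟩, h.2⟩, wts]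
      simp [h.1]

/-! ### Convergence at the radius, and the inequality -/

theorem genFun_ofReal {t : ℝ} (ht : 0 ≤ t)
    (h : Summable (fun n : ℕ => (count n : ℝ) * t ^ n)) :
    genFun (ENNReal.ofReal t) = ENNReal.ofReal (P t) := by
  unfold P
  rw [genFun_eq, ENNReal.ofReal_tsum_of_nonneg (fun n => by positivity) h]
  refine tsum_congr fun n => ?_
  rw [ENNReal.ofReal_mul (by positivity), ENNReal.ofReal_pow ht, ENNReal.ofReal_natCast]

theorem one_add_mul_sq_le {t : ℝ} (ht : 0 ≤ t)
    (h : Summable (fun n : ℕ => (count n : ℝ) * t ^ n)) : 1 + t * P t ^ 2 ≤ P t := by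
  have h0 : 0 ≤ P t := tsum_nonneg fun n => by positivity
  have h1 := genFun_mul_le (ENNReal.ofReal t)
  rw [genFun_ofReal ht h, ← ENNReal.ofReal_pow h0, ← ENNReal.ofReal_mul ht, ← ENNReal.ofReal_one,
    ← ENNReal.ofReal_add zero_le_one (by positivity), ENNReal.ofReal_le_ofReal_iff h0] at h1
  exact h1

theorem summable_of_lt_radius {t : ℝ} (ht : 0 ≤ t) (h : ENNReal.ofReal t < radius) :
    Summable (fun n : ℕ => (count n : ℝ) * t ^ n) := by
  have := FormalMultilinearSeries.summable_norm_mul_pow _ (r := t.toNNReal) h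
  refine this.congr fun n => ?_
  rw [FormalMultilinearSeries.ofScalars_norm, Real.coe_toNNReal t ht]
  simp

/-- Below the radius, `1 + t P² ≤ P` gives `t P ≤ 1`, and this bound on the partial sums extends to the
radius by continuity. -/
theorem summable_of_le_radius {t : ℝ} (ht : 0 ≤ t) (h : ENNReal.ofReal t ≤ radius) :
    Summable (fun n : ℕ => (count n : ℝ) * t ^ n) := by
  rcases ht.eq_or_lt with rfl | ht'
  · refine summable_of_ne_finset_zero (s := {0}) fun n hn => ?_
    have : n ≠ 0 := by simpa using hn
    simp [this]
  have key : ∀ N, t * ∑ n ∈ Finset.range N, (count n : ℝ) * t ^ n ≤ 1 := by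
    intro N
    have hc : Continuous fun r : ℝ => r * ∑ n ∈ Finset.range N, (count n : ℝ) * r ^ n := by
      fun_prop
    refine le_of_tendsto (hc.continuousWithinAt (s := Set.Iio t) (x := t)) ?_
    filter_upwards [Ioo_mem_nhdsLT ht'] with r hr
    have hs := summable_of_lt_radius hr.1.le
      (((ENNReal.ofReal_lt_ofReal_iff ht').2 hr.2).trans_le h)
    have h1 := one_add_mul_sq_le hr.1.le hs
    have h2 : ∑ n ∈ Finset.range N, (count n : ℝ) * r ^ n ≤ P r :=
      hs.sum_le_tsum _ fun n _ => mul_nonneg (Nat.cast_nonneg _) (pow_nonneg hr.1.le _)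
    have h3 : 0 < P r := by nlinarith [mul_nonneg hr.1.le (sq_nonneg (P r))]
    calc r * ∑ n ∈ Finset.range N, (count n : ℝ) * r ^ n ≤ r * P r :=
          mul_le_mul_of_nonneg_left h2 hr.1.le
      _ ≤ 1 := by
        by_contra! h4
        nlinarith
  refine summable_of_sum_range_le (c := 1 / t) (fun n => by positivity) fun N => ?_
  rw [le_div_iff₀ ht', mul_comm]
  exact key N

theorem le_one_of_pow_le {c x : ℝ} (hc : 0 < c)
    (h : ∀ r : ℕ, c * x ^ r ≤ (2 * (r + 2) + 1) ^ 2) : x ≤ 1 := by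
  by_contra! hx
  have h1 := (tendsto_pow_const_div_const_pow_of_one_lt 2 hx).const_mul 49
  rw [mul_zero] at h1
  have h2 : c ≤ 0 := by
    refine ge_of_tendsto h1 ?_
    filter_upwards [Filter.eventually_ge_atTop 1] with r hr
    have hr' : (1 : ℝ) ≤ r := by exact_mod_cast hr
    have hp : 0 < x ^ r := pow_pos (by linarith) r
    rw [← mul_div_assoc, le_div_iff₀ hp]
    refine (h r).trans ?_
    nlinarith
  linarith

/-- With `b = 1 - p / (2 σ² (1 + p))`, the coloured words have total weight at most `p`, so their growth
rate gives `σ (2 + √(2 b)) ≤ 1`. Solved for `p`, this is the claim. -/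
theorem one_le_two_mul_one_add_archSum_mul_sq {σ p : NNReal} (hσ : σ ≠ 0) (hσ2 : 2 * (σ : ℝ) ≤ 1)
    (hp : archSum σ = p) : 1 ≤ 2 * (1 + (p : ℝ)) * (1 - σ) ^ 2 := by
  have hσ0 : (0 : ℝ) < σ := NNReal.coe_pos.2 (pos_iff_ne_zero.2 hσ)
  have hp0 : (0 : ℝ) ≤ p := p.2
  have hden : 0 < 2 * (σ : ℝ) ^ 2 * (1 + p) := by positivity
  rcases le_or_gt (2 * (σ : ℝ) ^ 2 * (1 + p)) (p : ℝ) with hcase | hcase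
  · -- here `b ≤ 0`, and the bound on `p` from this alone suffices since `(1 - 2 σ)² ≥ 0`
    nlinarith [mul_nonneg (by positivity : (0 : ℝ) ≤ 1 + p) (sq_nonneg (1 - 2 * (σ : ℝ)))]
  · obtain ⟨b, hb⟩ : ∃ b : NNReal, (b : ℝ) = 1 - p / (2 * (σ : ℝ) ^ 2 * (1 + p)) := by
      refine ⟨⟨1 - p / (2 * (σ : ℝ) ^ 2 * (1 + p)), ?_⟩, rfl⟩
      rw [sub_nonneg, div_le_one hden]
      exact hcase.le
    have hb0 : (0 : ℝ) < b := by
      rw [hb, sub_pos, div_lt_one hden]; exact hcase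
    have hb1 : (b : ℝ) ≤ 1 := by
      rw [hb]; linarith [div_nonneg hp0 hden.le]
    have hbeq : 2 * (σ : ℝ) ^ 2 * (1 + p) * (1 - b) = p := by
      rw [hb]; field_simp; ring
    have hcol : ∀ N, colSum σ b N ≤ archSum σ := by
      refine colSum_le (by rw [hp]; exact ENNReal.coe_ne_top) ?_
      rw [hp]
      norm_cast
      rw [← NNReal.coe_le_coe]
      push_cast
      nlinarith
    have hfin : validSum σ b ≠ ⊤ :=
      ((validSum_le hcol).trans_lt (by rw [hp]; exact ENNReal.coe_lt_top)).ne
    have hβ : (NNReal.sqrt b : ℝ) ≤ Real.sqrt 2 := by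
      rw [Real.coe_sqrt]
      exact Real.sqrt_le_sqrt (by linarith)
    have hgrow : ∀ r : ℕ, ((σ : ℝ) ^ 2 * Real.sqrt b ^ 2) *
        (σ * (2 + Real.sqrt 2 * Real.sqrt b)) ^ r ≤ (2 * (r + 2) + 1) ^ 2 := by
      intro r
      have := growth_bound (s := σ) (b := b) (β := NNReal.sqrt b) (k := NNReal.sqrt 2)
        (by exact_mod_cast hσ) hfin (by norm_cast; rw [NNReal.mul_self_sqrt])
        (by norm_cast; rw [NNReal.mul_self_sqrt])
        (by norm_cast; rw [← NNReal.coe_le_coe]; simpa using hβ) r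
      norm_cast at this
      rw [← NNReal.coe_le_coe] at this
      push_cast at this
      simpa using this
    have hb2 : Real.sqrt b ^ 2 = b := Real.sq_sqrt hb0.le
    have h1 := le_one_of_pow_le (by rw [hb2]; positivity) hgrow
    have h2 : (σ : ℝ) * (Real.sqrt 2 * Real.sqrt b) ≤ 1 - 2 * σ := by linarith
    have h3 : ((σ : ℝ) * (Real.sqrt 2 * Real.sqrt b)) ^ 2 ≤ (1 - 2 * σ) ^ 2 :=
      pow_le_pow_left₀ (by positivity) h2 2
    rw [mul_pow, mul_pow, hb2, Real.sq_sqrt zero_le_two] at h3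
    nlinarith

end TwoStacks

theorem theorem2 (t : ℝ) (ht₀ : 0 ≤ t) (ht : ENNReal.ofReal t ≤ TwoStacks.radius) :
    Summable (fun n : ℕ => (TwoStacks.count n : ℝ) * t ^ n) ∧
      1 + Real.sqrt (2 * t * TwoStacks.P t) ≤ Real.sqrt (2 * TwoStacks.P t) := by
  have hs := TwoStacks.summable_of_le_radius ht₀ ht
  refine ⟨hs, ?_⟩
  have hP := TwoStacks.one_add_mul_sq_le ht₀ hs
  set P := TwoStacks.P t with hPdef
  have hP1 : 1 ≤ P := by nlinarith [mul_nonneg ht₀ (sq_nonneg P)]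
  have hσt : Real.sqrt t ^ 2 = t := Real.sq_sqrt ht₀
  have hσ0 := Real.sqrt_nonneg t
  -- the discriminant of `1 + t P² ≤ P`
  have h4 : 4 * t ≤ 1 := by nlinarith [sq_nonneg (2 * t * P - 1)]
  have hσ2 : 2 * Real.sqrt t ≤ 1 := by nlinarith
  have key : 1 ≤ 2 * P * (1 - Real.sqrt t) ^ 2 := by
    rcases ht₀.eq_or_lt with rfl | ht'
    · simp; linarith
    · have hA := TwoStacks.one_add_archSum_le (ENNReal.ofReal (Real.sqrt t))
      rw [← ENNReal.ofReal_pow hσ0, hσt, TwoStacks.genFun_ofReal ht₀ hs, ← hPdef] at hA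
      have hfin : TwoStacks.archSum (ENNReal.ofReal (Real.sqrt t)) ≠ ⊤ := by
        intro h
        rw [h, add_top] at hA
        exact ENNReal.ofReal_ne_top (top_le_iff.1 hA)
      obtain ⟨p, hp⟩ : ∃ p : NNReal, (p : ℝ≥0∞) = _ := ⟨_, ENNReal.coe_toNNReal hfin⟩
      have h1 : 1 + (p : ℝ) ≤ P := by
        rw [← hp, ENNReal.ofReal] at hA
        norm_cast at hA
        rw [← NNReal.coe_le_coe, Real.coe_toNNReal P (by linarith)] at hA
        exact_mod_cast hA
      have hc : ((Real.sqrt t).toNNReal : ℝ) = Real.sqrt t := Real.coe_toNNReal _ hσ0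
      have h2 := TwoStacks.one_le_two_mul_one_add_archSum_mul_sq (σ := (Real.sqrt t).toNNReal) (p := p)
        (by simpa using Real.sqrt_pos.2 ht') (by rw [hc]; exact hσ2) hp.symm
      rw [hc] at h2
      refine h2.trans ?_
      have := sq_nonneg (1 - Real.sqrt t)
      nlinarith
  have e1 : Real.sqrt (2 * t * P) = Real.sqrt t * Real.sqrt (2 * P) := by
    rw [← Real.sqrt_mul ht₀]; congr 1; ring
  have h5 : 1 ≤ Real.sqrt (2 * P) * (1 - Real.sqrt t) := by
    have h6 : Real.sqrt (2 * P * (1 - Real.sqrt t) ^ 2) =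
        Real.sqrt (2 * P) * (1 - Real.sqrt t) := by
      rw [Real.sqrt_mul (by linarith), Real.sqrt_sq (by linarith)]
    rw [← h6]
    exact Real.one_le_sqrt.2 key
  rw [e1]
  linarith
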